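/- **Theorem (type $B$ over $\mathbb{Z}$).** Let $T$ be a compact torus of dimension $n$, let $t_1,\dots,t_n$ be a basis of $H^2(BT)$ (so $H^*(BT)=\mathbb{Z}[t_1,\dots,t_n]$ with $\deg t_i=2$), and give $H^2(BT)$ the inner product for which this basis is orthonormal. Let $$\Phi(B_n)=\{\pm(t_i+t_j),\ \pm(t_i-t_j),\ \pm t_k \mid 1\le i<j\le n,\ 1\le k\le n\},$$ and let $\mathcal{B}_n$ be its labeled graph: the vertices are the elements of the Weyl group $W$ of $\Phi(B_n)$ (the group generated by the reflections $\sigma_\alpha$, $\alpha\in\Phi(B_n)$), and $w,w'\in W$ are connected by an edge, with label $w\alpha$ (well defined up to sign), if and only if $w'=w\sigma_\alpha$ for some $\alpha\in\Phi(B_n)$. Let $H_T^*(\mathcal{B}_n)$ be the graded ring of all maps $h\colon W\to H^*(BT)$ such that $h(w)-h(w')$ is divisible in $H^*(BT)$ by the label of the edge whenever $w$ and $w'$ are connected by an edge; the grading is the one induced from $H^*(BT)$. Write $\tau_i$ and $t_i$ for the maps $w\mapsto w(t_i)$ and $w\mapsto t_i$ on $W$, and let $e_i(\tau)$ and $e_i(t)$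 be the $i$-th elementary symmetric polynomials in $\tau_1,\dots,\tau_n$ and in $t_1,\dots,t_n$. Then $\tau_i$, $t_i$ and $f_i:=(e_i(\tau)-e_i(t))/2$ $(1\le i\le n)$ are elements of $H_T^*(\mathcal{B}_n)$ (in particular the division by $2$ is possible), and sending the variables $\tau_i,t_i,f_i$ to these elements induces an isomorphism of graded rings $$\mathbb{Z}[\tau_1,\dots,\tau_n,t_1,\dots,t_n,f_1,\dots,f_n]/I\ \cong\ H_T^*(\mathcal{B}_n),\qquad \deg\tau_i=\deg t_i=2,\ \deg f_i=2i,$$ where $I$ is the ideal generated by $$2f_i-e_i(\tau)+e_i(t)\quad(i=1,\dots,n),\qquad \sum_{j=1}^{2k}(-1)^jf_j\bigl(f_{2k-j}+e_{2k-j}(t)\bigr)\quad(k=1,\dots,n),$$ with the conventions $f_0=0$, $e_0(t)=1$ and $f_\ell=e_\ell(t)=0$ for $\ell>n$. -/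

import Mathlib

namespace GKM

open MvPolynomial

/-- `H²(BT)` for a compact torus `T` of dimension `n`, as the free abelian group on the
basis `t_1, …, t_n` (indexed by `Fin n`). -/
abbrev H2 (n : ℕ) : Type := Fin n → ℤ

/-- `H^*(BT) = ℤ[t_1, …, t_n]`; each `t_i` has cohomological degree `2`. -/
abbrev HBT (n : ℕ) : Type := MvPolynomial (Fin n) ℤ

/-- The basis element `t_i` of `H²(BT)`. -/
def tBasis {n : ℕ} (i : Fin n) : H2 n := Pi.single i 1

/-- The inclusion of `H²(BT)` into `H^*(BT)` as the linear polynomials. -/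
noncomputable def toHBT {n : ℕ} (v : H2 n) : HBT n := ∑ i, v i • X i

/-- A labeled graph: `Joins v v' l` says that there is an edge with label `l` in `H²(BT)`
connecting the vertices `v` and `v'`. -/
structure LabeledGraph (n : ℕ) where
  V : Type
  Joins : V → V → H2 n → Prop

/-- The graph cohomology ring `H_T^*(G)`: all `h : V(G) → H^*(BT)` such that `h(v) - h(v')` is
divisible by the label of every edge connecting `v` and `v'`. -/
def graphCohomology {n : ℕ} (G : LabeledGraph n) : Subring (G.V → HBT n) where
  carrier := {h | ∀ v v' l, G.Joins v v' l → toHBT l ∣ h v - h v'}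
  zero_mem' := by
    intro v v' l _
    simp
  one_mem' := by
    intro v v' l _
    simp
  add_mem' := by
    intro a b ha hb v v' l h
    have := dvd_add (ha v v' l h) (hb v v' l h)
    rwa [← add_sub_add_comm] at this
  neg_mem' := by
    intro a ha v v' l h
    have := (dvd_neg (α := HBT n)).2 (ha v v' l h)
    rw [neg_sub'] at this
    exact this
  mul_mem' := by
    intro a b ha hb v v' l h
    have h1 := dvd_mul_of_dvd_right (ha v v' l h) (b v)
    have h2 := dvd_mul_of_dvd_right (hb v v' l h) (a v')
    have h3 : (a * b) v - (a * b) v' = b v * (a v - a v') + a v' * (b v - b v') := by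
      simp only [Pi.mul_apply]
      ring
    rw [h3]
    exact dvd_add h1 h2

/-- The element `h` of `H_T^*(G)` is homogeneous of cohomological degree `d` (the grading is
induced from that of `H^*(BT)`, in which every `t_i` has degree `2`). -/
def IsInDegree {n : ℕ} {G : LabeledGraph n} (h : graphCohomology G) (d : ℕ) : Prop :=
  ∀ v, IsWeightedHomogeneous (fun _ : Fin n => 2) (h.1 v) d

/-- `s` is the reflection `σ_α` of `H²(BT)` determined by `α`, with respect to the inner product
for which `t_1, …, t_n` are orthonormal: `σ_α(x) = x - (2⟨x,α⟩ / ⟨α,α⟩) α`, with the denominator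
cleared. -/
def IsReflection {n : ℕ} (α : H2 n) (s : H2 n ≃ₗ[ℤ] H2 n) : Prop :=
  ∀ x, (α ⬝ᵥ α) • s x = (α ⬝ᵥ α) • x - (2 * (x ⬝ᵥ α)) • α

/-- The Weyl group of `Φ`: the group generated by the reflections `σ_α`, `α ∈ Φ`. -/
def weylGroup {n : ℕ} (Φ : Set (H2 n)) : Subgroup (H2 n ≃ₗ[ℤ] H2 n) :=
  Subgroup.closure {s | ∃ α ∈ Φ, IsReflection α s}

/-- The labeled graph of a root system `Φ`: the vertices are the elements of the Weyl group, and
`w`, `w'` are connected by an edge with label `w α` if `w' = w σ_α` with `α ∈ Φ`.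
(As `σ_α = σ_{-α}`, an edge carries its label up to sign, which does not affect divisibility.) -/
def rootGraph {n : ℕ} (Φ : Set (H2 n)) : LabeledGraph n where
  V := weylGroup Φ
  Joins w w' l := ∃ α ∈ Φ, ∃ s : H2 n ≃ₗ[ℤ] H2 n, IsReflection α s ∧
    (w' : H2 n ≃ₗ[ℤ] H2 n) = w * s ∧ l = (w : H2 n ≃ₗ[ℤ] H2 n) α

/-- The root system of type `B_n`: `±(t_i + t_j)`, `±(t_i - t_j)` for `i < j`, and `±t_k`. -/
def rootsB (n : ℕ) : Set (H2 n) :=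
  {α | (∃ i j : Fin n, i < j ∧
      (α = tBasis i + tBasis j ∨ α = -(tBasis i + tBasis j) ∨
        α = tBasis i - tBasis j ∨ α = -(tBasis i - tBasis j))) ∨
    ∃ k : Fin n, α = tBasis k ∨ α = -tBasis k}

/-- Every root of type `B_n` does have a (unique) reflection on the lattice `H²(BT)`. -/
theorem existsUnique_isReflection_of_mem_rootsB {n : ℕ} {α : H2 n} (hα : α ∈ rootsB n) :
    ∃! s : H2 n ≃ₗ[ℤ] H2 n, IsReflection α s := by
  have hc : ∃ c : ℤ, c * (α ⬝ᵥ α) = 2 := by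
    rcases hα with ⟨i, j, hij, h⟩ | ⟨k, h⟩
    · refine ⟨1, ?_⟩
      have h1 := hij.ne
      have h2 := hij.ne'
      rcases h with rfl | rfl | rfl | rfl <;> simp [tBasis, h1, h2]
    · refine ⟨2, ?_⟩
      rcases h with rfl | rfl <;> simp [tBasis]
  obtain ⟨c, hc⟩ := hc
  have hne : (α ⬝ᵥ α) ≠ 0 := by
    intro h
    simp [h] at hc
  let f : Module.Dual ℤ (H2 n) :=
    { toFun := fun x => c * (x ⬝ᵥ α)
      map_add' := fun x y => by simp [add_dotProduct, mul_add]
      map_smul' := fun r x => by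
        rw [smul_dotProduct, smul_eq_mul, mul_left_comm]
        rfl }
  have hf : f α = 2 := hc
  refine ⟨Module.reflection hf, ?_, ?_⟩
  · intro x
    have hx : f x = c * (x ⬝ᵥ α) := rfl
    rw [Module.reflection_apply, hx, smul_sub, smul_smul, ← hc]
    congr 2
    ring
  · intro s hs
    refine LinearEquiv.ext fun x => smul_right_injective (H2 n) hne ?_
    have hx : f x = c * (x ⬝ᵥ α) := rfl
    have h := hs x
    change (α ⬝ᵥ α) • s x = (α ⬝ᵥ α) • Module.reflection hf x
    rw [h, Module.reflection_apply, hx, smul_sub, smul_smul, ← hc]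
    congr 2
    ring

/-- The labeled graph `B_n`. -/
def graphB (n : ℕ) : LabeledGraph n := rootGraph (rootsB n)

/-- `τ_i : V(B_n) → H^*(BT)`, `τ_i(w) = t_{w(i)}`, where `t_{w(i)} = w t_i` and `t_{-m} = -t_m`. -/
noncomputable def tau {n : ℕ} (i : Fin n) : (graphB n).V → HBT n :=
  fun w => toHBT ((w : weylGroup (rootsB n)).1 (tBasis i))

/-- `t_i : V(B_n) → H^*(BT)`, the constant function with value `t_i`. -/
noncomputable def tConst {n : ℕ} (i : Fin n) : (graphB n).V → HBT n :=
  fun _ => X i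

/-- Names of the polynomial generators `τ_i`, `t_i`, `f_i`; for `i : Fin n` the generator `f i` is
the one written `f_{i+1}`, with `1 ≤ i + 1 ≤ n`. -/
inductive Gen (n : ℕ) : Type
  | tau (i : Fin n) : Gen n
  | t (i : Fin n) : Gen n
  | f (i : Fin n) : Gen n

/-- The cohomological degrees: `deg τ_i = deg t_i = 2` and `deg f_i = 2 i`. -/
def Gen.deg {n : ℕ} : Gen n → ℕ
  | .tau _ => 2
  | .t _ => 2
  | .f i => 2 * ((i : ℕ) + 1)

/-- `ℤ[τ_1, …, τ_n, t_1, …, t_n, f_1, …, f_n]`. -/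
abbrev PolyB (n : ℕ) : Type := MvPolynomial (Gen n) ℤ

/-- The elementary symmetric polynomial `e_l(τ)` (it is `0` for `l > n`). -/
noncomputable def eTau (n l : ℕ) : PolyB n := rename Gen.tau (esymm (Fin n) ℤ l)

/-- The elementary symmetric polynomial `e_l(t)` (it is `0` for `l > n`). -/
noncomputable def eT (n l : ℕ) : PolyB n := rename Gen.t (esymm (Fin n) ℤ l)

/-- The variable `f_l` for `1 ≤ l ≤ n`, with `f_0 = 0` and `f_l = 0` for `l > n`. -/
noncomputable def fVar (n : ℕ) : ℕ → PolyB n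
  | 0 => 0
  | l + 1 => if h : l < n then X (Gen.f ⟨l, h⟩) else 0

/-- The ideal generated by `2 f_i - e_i(τ) + e_i(t)` (`1 ≤ i ≤ n`) and
`∑_{j=1}^{2k} (-1)^j f_j (f_{2k-j} + e_{2k-j}(t))` (`1 ≤ k ≤ n`). -/
noncomputable def idealB (n : ℕ) : Ideal (PolyB n) :=
  Ideal.span
    ({p | ∃ i ∈ Finset.Icc 1 n, p = 2 * fVar n i - eTau n i + eT n i} ∪
      {p | ∃ k ∈ Finset.Icc 1 n, p = ∑ j ∈ Finset.Icc 1 (2 * k),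
        (-1) ^ j * fVar n j * (fVar n (2 * k - j) + eT n (2 * k - j))})

end GKM

namespace GKM
open MvPolynomial

/-! ### The Weyl group of type B as signed permutations -/

section WeylGroup
variable {n : ℕ}

/-! Evaluating the generators at a vertex `w` gives a homomorphism `evalAt w` to ℤ[t]. Taken over
all `w`, these must be shown to land in the graph cohomology, to fill it, and to have common kernel
I.

Elements of W are signed permutations of the t_i. Hence e_i(τ) ≡ e_i(t) mod 2, and ∏(1 - τ_i²x²) =
∏(1 - t_i²x²); comparing coefficients and dividing by 4 gives the quadratic relations
(`idealB_le_ker`). Along an edge each τ_i changes by a multiple of the label, and so does f_i,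
because the label is a prime that does not divide 2 (`toHBT_dvd_evalAt_sub`).

Surjectivity is a Newton interpolation (`exists_evalAt_eq_insert`). The vertices agreeing with `w₀`
on t_j for all j > m split into fibres according to the value of w(t_m), which is one of ±u_k with
u_k = w₀(t_k), k ≤ m. The fibres are treated one at a time. If h already agrees with a polynomial p
on earlier fibres, then on the fibre of a the difference h - p is divisible by the labels of the
edges to those fibres, and the quotient is handled by induction on m. What is needed is a polynomial
equal to the product of these labels on the fibre and zero on the earlier ones. For the values u_k a
product of differences τ_m - b works. Once -a has occurred, this product is twice too large, because
the label joining a to -a is a and not 2a. The f_i supply the missing half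
(`exists_half_multiplier`).

Injectivity is a count. Over ℤ[t], the quadratic relations reduce monomials in the f_i to 2^n
squarefree ones, and the τ_i are adjoined successively as roots of monic polynomials of degrees n,
n-1, …, 1. So the quotient is spanned by 2^n n! ≤ |W| elements (`isSpannedBy_top`). The |W|
evaluations separate vertices, so a determinant argument makes them jointly injective
(`eq_zero_of_forall_eq_zero`). -/

theorem dotProduct_tBasis (x : H2 n) (i : Fin n) : x ⬝ᵥ tBasis i = x i := by
  simp [tBasis]

theorem tBasis_dotProduct (x : H2 n) (i : Fin n) : tBasis i ⬝ᵥ x = x i := by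
  simp [tBasis]

theorem tBasis_dotProduct_self (i : Fin n) : tBasis i ⬝ᵥ tBasis i = 1 := by
  simp [tBasis]

theorem tBasis_dotProduct_of_ne {i j : Fin n} (h : i ≠ j) : tBasis i ⬝ᵥ tBasis j = 0 := by
  simp [tBasis, h.symm]

/-- Integral vectors of norm one are signed basis vectors. -/
theorem exists_eq_tBasis_or_neg {a : H2 n} (ha : a ⬝ᵥ a = 1) :
    ∃ k, a = tBasis k ∨ a = -tBasis k := by
  have hk : ∃ k, a k ≠ 0 := by
    by_contra! h
    have : a = 0 := funext h
    simp [this] at ha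
  obtain ⟨k, hk⟩ := hk
  have hsum : a k * a k + ∑ i ∈ Finset.univ.erase k, a i * a i = 1 := by
    rw [Finset.add_sum_erase _ (fun i => a i * a i) (Finset.mem_univ k)]
    exact ha
  have hnn : ∀ i ∈ Finset.univ.erase k, 0 ≤ a i * a i := fun i _ => mul_self_nonneg _
  have h0 := Finset.sum_nonneg hnn
  have h1 : 1 ≤ a k * a k := mul_self_pos.2 hk
  have h2 : ∑ i ∈ Finset.univ.erase k, a i * a i = 0 := by omega
  have h3 : a k * a k = 1 := by omega
  have h4 : ∀ i, i ≠ k → a i = 0 := fun i hi =>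
    mul_self_eq_zero.1 ((Finset.sum_eq_zero_iff_of_nonneg hnn).1 h2 i (by simp [hi]))
  refine ⟨k, ?_⟩
  rcases mul_self_eq_one_iff.1 h3 with h | h
  · left
    ext i
    by_cases hi : i = k
    · subst hi; simp [tBasis, h]
    · simp [tBasis, h4 i hi, hi]
  · right
    ext i
    by_cases hi : i = k
    · subst hi; simp [tBasis, h]
    · simp [tBasis, h4 i hi, hi]

theorem rootsB_dotProduct_self_ne_zero {α : H2 n} (hα : α ∈ rootsB n) : α ⬝ᵥ α ≠ 0 := by
  intro h
  rw [dotProduct_self_eq_zero] at h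
  subst h
  obtain ⟨s, hs, hu⟩ := existsUnique_isReflection_of_mem_rootsB hα
  rcases hα with ⟨i, j, hij, h⟩ | ⟨k, h⟩
  · have := hij.ne
    rcases h with h | h | h | h <;> simpa [tBasis, this] using congrFun h i
  · rcases h with h | h <;> simpa [tBasis] using congrFun h k

theorem IsReflection.dotProduct_apply {α : H2 n} {s : H2 n ≃ₗ[ℤ] H2 n} (hs : IsReflection α s)
    (hα : α ⬝ᵥ α ≠ 0) (x y : H2 n) : s x ⬝ᵥ s y = x ⬝ᵥ y := by
  have h : ((α ⬝ᵥ α) • s x) ⬝ᵥ ((α ⬝ᵥ α) • s y) = (α ⬝ᵥ α) * (α ⬝ᵥ α) * (x ⬝ᵥ y) := by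
    rw [hs x, hs y]
    simp only [sub_dotProduct, dotProduct_sub, smul_dotProduct, dotProduct_smul, smul_eq_mul]
    rw [dotProduct_comm α y]
    ring
  rw [smul_dotProduct, dotProduct_smul, smul_eq_mul, smul_eq_mul, ← mul_assoc] at h
  exact mul_left_cancel₀ (mul_ne_zero hα hα) h

theorem weylGroup_dotProduct {w : H2 n ≃ₗ[ℤ] H2 n} (hw : w ∈ weylGroup (rootsB n)) :
    ∀ x y, w x ⬝ᵥ w y = x ⬝ᵥ y := by
  induction hw using Subgroup.closure_induction with
  | mem s hs =>
    obtain ⟨α, hα, hs⟩ := hs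
    exact hs.dotProduct_apply (rootsB_dotProduct_self_ne_zero hα)
  | one => intro x y; rfl
  | mul a b _ _ ha hb => intro x y; rw [LinearEquiv.mul_apply, LinearEquiv.mul_apply, ha, hb]
  | inv a _ ha =>
    intro x y
    rw [← ha (a⁻¹ x) (a⁻¹ y), ← LinearEquiv.mul_apply, ← LinearEquiv.mul_apply, mul_inv_cancel]
    rfl

theorem reflection_mem_weylGroup {α : H2 n} (hα : α ∈ rootsB n) {s : H2 n ≃ₗ[ℤ] H2 n}
    (hs : IsReflection α s) : s ∈ weylGroup (rootsB n) :=
  Subgroup.subset_closure ⟨α, hα, hs⟩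

theorem linearEquiv_ext_tBasis {w w' : H2 n ≃ₗ[ℤ] H2 n}
    (h : ∀ i, w (tBasis i) = w' (tBasis i)) : w = w' := by
  apply LinearEquiv.toLinearMap_injective
  refine (Pi.basisFun ℤ (Fin n)).ext fun i => ?_
  simpa [tBasis] using h i

/-- Both sides of the reflection formula are linear in the vector, so a basis suffices. -/
theorem isReflection_iff_tBasis {α : H2 n} {s : H2 n ≃ₗ[ℤ] H2 n} :
    IsReflection α s ↔
      ∀ i, (α ⬝ᵥ α) • s (tBasis i) = (α ⬝ᵥ α) • tBasis i - (2 * α i) • α := by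
  constructor
  · intro h i
    rw [h, tBasis_dotProduct]
  · intro h x
    let f : H2 n →ₗ[ℤ] H2 n := (α ⬝ᵥ α) • s.toLinearMap
    let g : H2 n →ₗ[ℤ] H2 n :=
      { toFun := fun x => (α ⬝ᵥ α) • x - (2 * (x ⬝ᵥ α)) • α
        map_add' := fun x y => by rw [add_dotProduct]; module
        map_smul' := fun r x => by
          rw [smul_dotProduct, smul_eq_mul, RingHom.id_apply]; module }
    have : f = g := by
      refine (Pi.basisFun ℤ (Fin n)).ext fun i => ?_
      have := h i
      rw [← tBasis_dotProduct α i] at this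
      simpa [f, g, tBasis] using this
    exact LinearMap.congr_fun this x

/-- The linear automorphism permuting the basis vectors. -/
def permEquiv : Equiv.Perm (Fin n) →* (H2 n ≃ₗ[ℤ] H2 n) where
  toFun σ := LinearEquiv.funCongrLeft ℤ ℤ σ.symm
  map_one' := rfl
  map_mul' _ _ := rfl

theorem permEquiv_tBasis (σ : Equiv.Perm (Fin n)) (i : Fin n) :
    permEquiv σ (tBasis i) = tBasis (σ i) := by
  ext j
  change (Pi.single i 1 : Fin n → ℤ) (σ.symm j) = (Pi.single (σ i) 1 : Fin n → ℤ) j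
  simp [Pi.single_apply, Equiv.symm_apply_eq]

/-- The linear automorphism changing signs of the basis vectors. -/
def signEquiv : (Fin n → ℤˣ) →* (H2 n ≃ₗ[ℤ] H2 n) where
  toFun ε := LinearEquiv.piCongrRight fun i => LinearEquiv.smulOfUnit (ε i)
  map_one' := by
    apply LinearEquiv.ext; intro x; ext i
    simp [LinearEquiv.smulOfUnit]
  map_mul' a b := by
    apply LinearEquiv.ext; intro x; ext i
    simp [LinearEquiv.smulOfUnit, mul_smul, smul_comm (a i)]

theorem signEquiv_tBasis (ε : Fin n → ℤˣ) (i : Fin n) :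
    signEquiv ε (tBasis i) = (ε i : ℤ) • tBasis i := by
  ext j
  by_cases h : j = i
  · subst h
    simp [signEquiv, tBasis, LinearEquiv.smulOfUnit, Units.smul_def]
  · simp [signEquiv, tBasis, LinearEquiv.smulOfUnit, h]

theorem tBasis_sub_mem_rootsB {i j : Fin n} (h : i ≠ j) : tBasis i - tBasis j ∈ rootsB n := by
  rcases lt_or_gt_of_ne h with h | h
  · exact Or.inl ⟨i, j, h, by simp⟩
  · exact Or.inl ⟨j, i, h, by simp⟩

theorem tBasis_add_mem_rootsB {i j : Fin n} (h : i ≠ j) : tBasis i + tBasis j ∈ rootsB n := by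
  rcases lt_or_gt_of_ne h with h | h
  · exact Or.inl ⟨i, j, h, by simp⟩
  · exact Or.inl ⟨j, i, h, by simp [add_comm]⟩

theorem tBasis_mem_rootsB (i : Fin n) : tBasis i ∈ rootsB n := Or.inr ⟨i, Or.inl rfl⟩

/-- The transposition of i and j is the reflection in t_i - t_j. -/
theorem permEquiv_mem_weylGroup (σ : Equiv.Perm (Fin n)) :
    permEquiv σ ∈ weylGroup (rootsB n) := by
  induction σ using Equiv.Perm.swap_induction_on with
  | one => rw [map_one]; exact one_mem _
  | swap_mul σ i j hij ih =>
    rw [map_mul]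
    refine mul_mem (reflection_mem_weylGroup (tBasis_sub_mem_rootsB hij) ?_) ih
    rw [isReflection_iff_tBasis]
    intro k
    have h2 : (tBasis i - tBasis j : H2 n) ⬝ᵥ (tBasis i - tBasis j) = 2 := by
      simp [tBasis, hij, hij.symm]
    rw [permEquiv_tBasis, h2]
    rcases eq_or_ne k i with rfl | hi
    · ext l
      simp [tBasis, Pi.single_apply, hij]
      split_ifs <;> norm_num
    rcases eq_or_ne k j with rfl | hj
    · ext l
      simp [tBasis, Pi.single_apply, hij.symm]
      split_ifs <;> norm_num
    · rw [Equiv.swap_apply_of_ne_of_ne hi hj]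
      simp [tBasis, hi, hj]

/-- A single sign change is the reflection in t_i. -/
theorem signEquiv_mem_weylGroup (ε : Fin n → ℤˣ) : signEquiv ε ∈ weylGroup (rootsB n) := by
  have h : ε ∈ (weylGroup (rootsB n)).comap signEquiv := by
    rw [← Finset.univ_prod_mulSingle ε]
    refine Subgroup.prod_mem _ fun i _ => ?_
    rcases Int.units_eq_one_or (ε i) with h | h
    · rw [h, Pi.mulSingle_one]
      exact one_mem _
    · rw [h, Subgroup.mem_comap]
      refine reflection_mem_weylGroup (tBasis_mem_rootsB i) ?_
      rw [isReflection_iff_tBasis]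
      intro k
      rw [signEquiv_tBasis, tBasis_dotProduct_self]
      rcases eq_or_ne k i with rfl | hk
      · ext l
        simp [tBasis, Pi.single_apply]
        split_ifs <;> norm_num
      · simp [tBasis, hk]
  exact h

instance finite_weylGroup_rootsB : Finite (weylGroup (rootsB n)) := by
  have hf : Set.Finite {a : H2 n | a ⬝ᵥ a = 1} := by
    refine ((Set.finite_range (tBasis (n := n))).union
      (Set.finite_range fun k : Fin n => -tBasis k)).subset ?_
    intro a ha
    obtain ⟨k, h | h⟩ := exists_eq_tBasis_or_neg ha
    · exact Or.inl ⟨k, h.symm⟩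
    · exact Or.inr ⟨k, h.symm⟩
  have := hf.to_subtype
  let F : weylGroup (rootsB n) → Fin n → {a : H2 n | a ⬝ᵥ a = 1} := fun w i =>
    ⟨w.1 (tBasis i), by
      rw [Set.mem_ofPred_eq, weylGroup_dotProduct w.2, tBasis_dotProduct_self]⟩
  refine Finite.of_injective F fun w w' h => Subtype.ext (linearEquiv_ext_tBasis fun i => ?_)
  exact congrArg Subtype.val (congrFun h i)

/-- Distinct signed permutations act differently on the basis. The lower bound is enough for the
count in the injectivity argument, where a short spanning family is padded by zeros. -/
theorem card_weylGroup_rootsB_ge : 2 ^ n * n.factorial ≤ Nat.card (weylGroup (rootsB n)) := by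
  let F : (Fin n → ℤˣ) × Equiv.Perm (Fin n) → weylGroup (rootsB n) := fun p =>
    ⟨signEquiv p.1 * permEquiv p.2,
      mul_mem (signEquiv_mem_weylGroup _) (permEquiv_mem_weylGroup _)⟩
  have hF : Function.Injective F := by
    rintro ⟨a, σ⟩ ⟨b, τ⟩ h
    have h1 : ∀ i, (a (σ i) : ℤ) • (tBasis (σ i) : H2 n) = (b (τ i) : ℤ) • tBasis (τ i) := by
      intro i
      have := congrArg (fun w : weylGroup (rootsB n) => w.1 (tBasis i)) h
      simpa [F, LinearEquiv.mul_apply, permEquiv_tBasis, signEquiv_tBasis] using this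
    have h2 : σ = τ := by
      ext1 i
      by_contra hne
      have := congrFun (h1 i) (σ i)
      simp [tBasis, hne] at this
    subst h2
    have h3 : a = b := by
      funext i
      have := congrFun (h1 (σ.symm i)) i
      simp only [Equiv.apply_symm_apply] at this
      simpa [tBasis, Units.ext_iff] using this
    rw [h3]
  have h := Nat.card_le_card_of_injective F hF
  refine le_trans (le_of_eq ?_) h
  rw [Nat.card_prod, Nat.card_eq_fintype_card, Nat.card_eq_fintype_card, Fintype.card_perm,
    Fintype.card_fun, Fintype.card_fin]
  rfl

/-- Elements of the Weyl group are signed permutations of the basis. -/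
theorem exists_signed_perm (w : weylGroup (rootsB n)) :
    ∃ σ : Equiv.Perm (Fin n), ∀ i,
      w.1 (tBasis i) = tBasis (σ i) ∨ w.1 (tBasis i) = -tBasis (σ i) := by
  have h : ∀ i, ∃ k, w.1 (tBasis i) = tBasis k ∨ w.1 (tBasis i) = -tBasis k := fun i =>
    exists_eq_tBasis_or_neg (by rw [weylGroup_dotProduct w.2, tBasis_dotProduct_self])
  choose σ hσ using h
  have hinj : Function.Injective σ := by
    intro i j hij
    by_contra hne
    have h0 : w.1 (tBasis i) ⬝ᵥ w.1 (tBasis j) = 0 := by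
      rw [weylGroup_dotProduct w.2, tBasis_dotProduct_of_ne hne]
    have hi := hσ i
    have hj := hσ j
    rw [hij] at hi
    rcases hi with hi | hi <;> rcases hj with hj | hj <;>
      simp [hi, hj, tBasis_dotProduct_self] at h0
  exact ⟨Equiv.ofBijective σ (Finite.injective_iff_bijective.1 hinj), hσ⟩

end WeylGroup

/-! ### Divisibility by integral linear forms -/

section LinearForms
variable {n : ℕ}

theorem toHBT_add (v w : H2 n) : toHBT (v + w) = toHBT v + toHBT w := by
  simp [toHBT, add_mul, Finset.sum_add_distrib]

theorem toHBT_smul (c : ℤ) (v : H2 n) : toHBT (c • v) = c • toHBT v := by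
  simp [toHBT, Finset.mul_sum, mul_assoc]

theorem toHBT_neg (v : H2 n) : toHBT (-v) = -toHBT v := by
  simp [toHBT]

theorem toHBT_sub (v w : H2 n) : toHBT (v - w) = toHBT v - toHBT w := by
  rw [sub_eq_add_neg, toHBT_add, toHBT_neg, sub_eq_add_neg]

@[simp] theorem toHBT_tBasis (k : Fin n) : toHBT (tBasis k) = X k := by
  simp [toHBT, tBasis, Pi.single_apply]

theorem eval_toHBT (x v : H2 n) : eval x (toHBT v) = v ⬝ᵥ x := by
  simp [toHBT, dotProduct]

theorem not_toHBT_dvd {l x : H2 n} {p : HBT n} (h : l ⬝ᵥ x = 0) (hp : eval x p ≠ 0) :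
    ¬ toHBT l ∣ p := by
  rintro ⟨q, rfl⟩
  apply hp
  rw [map_mul, eval_toHBT, h, zero_mul]

theorem toHBT_ne_zero {v : H2 n} (hv : v ≠ 0) : toHBT v ≠ 0 := by
  intro h
  have := eval_toHBT v v
  rw [h, map_zero, eq_comm, dotProduct_self_eq_zero] at this
  exact hv this

theorem toHBT_injective : Function.Injective (toHBT (n := n)) := by
  intro v w h
  by_contra hne
  exact toHBT_ne_zero (sub_ne_zero.2 hne) (by rw [toHBT_sub, h, sub_self])

/-- Modulo l, the endomorphism and the identity agree on the variables, hence everywhere. -/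
theorem dvd_sub_algHom_apply {φ : HBT n →ₐ[ℤ] HBT n} {l : HBT n}
    (h : ∀ i, l ∣ X i - φ (X i)) (p : HBT n) : l ∣ p - φ p := by
  let q := Ideal.Quotient.mkₐ ℤ (Ideal.span {l})
  have : q = q.comp φ := by
    refine MvPolynomial.algHom_ext fun i => ?_
    exact (Ideal.Quotient.eq).2 (Ideal.mem_span_singleton.2 (h i))
  exact Ideal.mem_span_singleton.1 ((Ideal.Quotient.eq).1 (AlgHom.congr_fun this p))

/-- Since the k-th coefficient is a unit, the variable X_k can be eliminated: the substitution φ has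
kernel exactly the ideal generated by the form, and its target is a domain. -/
theorem prime_toHBT {l : H2 n} {k : Fin n} (hk : l k * l k = 1) : Prime (toHBT l) := by
  let φ : HBT n →ₐ[ℤ] HBT n :=
    aeval fun i => if i = k then X k - C (l k) * toHBT l else X i
  have hφ : ∀ p, φ p = 0 ↔ toHBT l ∣ p := by
    intro p
    have h1 : toHBT l ∣ p - φ p := by
      refine dvd_sub_algHom_apply (fun i => ?_) p
      by_cases hi : i = k
      · subst hi
        simp [φ]
      · simp [φ, hi]
    have h2 : φ (toHBT l) = 0 := by
      have h3 : φ (toHBT l) = toHBT l - l k • (C (l k) * toHBT l) := by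
        have h4 : ∀ t : HBT n, ∑ i, l i • (if i = k then X k - C (l k) * t else X i)
            = ∑ i, l i • X i - l k • (C (l k) * t) := by
          intro t
          have h5 : ∀ i, l i • (if i = k then X k - C (l k) * t else X i)
              = l i • X i - if i = k then l k • (C (l k) * t) else 0 := by
            intro i
            split_ifs with hi
            · rw [hi, smul_sub]
            · rw [sub_zero]
          rw [Finset.sum_congr rfl fun i _ => h5 i, Finset.sum_sub_distrib, Finset.sum_ite_eq',
            if_pos (Finset.mem_univ k)]
        refine Eq.trans ?_ (h4 (toHBT l))
        conv_lhs => rw [toHBT]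
        simp only [map_sum, map_zsmul, φ, aeval_X]
      rw [h3, smul_eq_C_mul, ← mul_assoc, ← C_mul, hk, C_1, one_mul, sub_self]
    constructor
    · intro h
      rwa [h, sub_zero] at h1
    · rintro ⟨q, rfl⟩
      rw [map_mul, h2, zero_mul]
  refine ⟨toHBT_ne_zero ?_, ?_, ?_⟩
  · rintro rfl
    simp at hk
  · intro hu
    have := hu.map (eval (0 : H2 n))
    rw [eval_toHBT, dotProduct_zero] at this
    exact not_isUnit_zero this
  · intro a b hab
    rw [← hφ, map_mul, mul_eq_zero, hφ, hφ] at hab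
    exact hab

theorem prime_toHBT_of_dotProduct {a d : H2 n} (ha : a ⬝ᵥ a = 1) (hd : d ⬝ᵥ a = 1) :
    Prime (toHBT d) := by
  obtain ⟨k, rfl | rfl⟩ := exists_eq_tBasis_or_neg ha
  · rw [dotProduct_tBasis] at hd
    exact prime_toHBT (k := k) (by rw [hd, one_mul])
  · rw [dotProduct_neg, dotProduct_tBasis, neg_eq_iff_eq_neg] at hd
    exact prime_toHBT (k := k) (by rw [hd]; norm_num)

/-- Distinct linear forms with value `1` at a signed basis vector are coprime, so divisibility by
each of them implies divisibility by their product. -/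
theorem prod_toHBT_dvd {ι : Type*} {J : Finset ι} {d : ι → H2 n} {a : H2 n} (ha : a ⬝ᵥ a = 1)
    (hd : ∀ j ∈ J, d j ⬝ᵥ a = 1) (hinj : Set.InjOn d J) {p : HBT n}
    (hp : ∀ j ∈ J, toHBT (d j) ∣ p) : ∏ j ∈ J, toHBT (d j) ∣ p := by
  refine Finset.prod_dvd_of_isRelPrime ?_ hp
  intro i hi j hj hij
  have hpi := prime_toHBT_of_dotProduct ha (hd i hi)
  refine (hpi.irreducible.isRelPrime_iff_not_dvd).2 ?_
  have hne : d j - d i ≠ 0 := fun h => hij (hinj hj hi (sub_eq_zero.1 h)).symm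
  -- Subtracting this multiple of a moves v = d_j - d_i onto the hyperplane d_i = 0; there d_j takes
  -- the value v·v ≠ 0.
  refine not_toHBT_dvd (x := (d j - d i) - (d i ⬝ᵥ (d j - d i)) • a) ?_ ?_
  · rw [dotProduct_sub, dotProduct_smul, hd i hi]
    simp
  · rw [eval_toHBT, dotProduct_sub, dotProduct_smul, hd j hj, smul_eq_mul, mul_one,
      ← sub_dotProduct]
    rwa [Ne, dotProduct_self_eq_zero]

/-- At the point a the form l vanishes while the product equals 1, so the prime l cannot divide the
product. -/
theorem dvd_of_dvd_prod_toHBT_mul {ι : Type*} {J : Finset ι} {d : ι → H2 n} {a l : H2 n}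
    (hd : ∀ j ∈ J, d j ⬝ᵥ a = 1) (hl : l ⬝ᵥ a = 0) (hprime : Prime (toHBT l)) {g : HBT n}
    (h : toHBT l ∣ (∏ j ∈ J, toHBT (d j)) * g) : toHBT l ∣ g := by
  refine (hprime.dvd_or_dvd h).resolve_left ?_
  refine not_toHBT_dvd hl ?_
  rw [map_prod, Finset.prod_congr rfl fun j hj => (eval_toHBT a (d j)).trans (hd j hj)]
  simp

theorem not_toHBT_dvd_two (l : H2 n) : ¬ toHBT l ∣ (2 : HBT n) :=
  not_toHBT_dvd (x := 0) (dotProduct_zero l) (by rw [map_ofNat]; norm_num)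

end LinearForms

/-! ### Identities for elementary symmetric polynomials -/

section ElementarySymmetric
variable {n : ℕ} {R S : Type*} [CommRing R] [CommRing S]

/-- The value of the `k`-th elementary symmetric polynomial at a finite family. -/
noncomputable def esymmAt (a : Fin n → R) (k : ℕ) : R := aeval a (esymm (Fin n) ℤ k)

theorem esymmAt_eq_sum (a : Fin n → R) (k : ℕ) :
    esymmAt a k = ∑ t ∈ Finset.powersetCard k Finset.univ, ∏ i ∈ t, a i := by
  simp [esymmAt, esymm]

theorem map_esymmAt {F : Type*} [FunLike F R S] [RingHomClass F R S] (φ : F) (a : Fin n → R)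
    (k : ℕ) : φ (esymmAt a k) = esymmAt (fun i => φ (a i)) k := by
  simp [esymmAt_eq_sum]

@[simp] theorem esymmAt_zero (a : Fin n → R) : esymmAt a 0 = 1 := by
  simp [esymmAt_eq_sum]

theorem esymmAt_of_lt (a : Fin n → R) {k : ℕ} (h : n < k) : esymmAt a k = 0 := by
  rw [esymmAt_eq_sum, Finset.powersetCard_eq_empty.2 (by simpa using h), Finset.sum_empty]

theorem esymmAt_perm (a : Fin n → R) (σ : Equiv.Perm (Fin n)) (k : ℕ) :
    esymmAt (fun i => a (σ i)) k = esymmAt a k := by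
  have h := esymm_isSymmetric (Fin n) ℤ k σ
  rw [esymmAt, esymmAt]
  conv_rhs => rw [← h, aeval_rename]
  rfl

theorem esymmAt_neg (a : Fin n → R) (k : ℕ) :
    esymmAt (fun i => -a i) k = (-1) ^ k * esymmAt a k := by
  rw [esymmAt_eq_sum, esymmAt_eq_sum, Finset.mul_sum]
  refine Finset.sum_congr rfl fun t ht => ?_
  rw [Finset.prod_neg, (Finset.mem_powersetCard.1 ht).2]

theorem coeff_prod_one_add (a : Fin n → R) (k : ℕ) :
    (∏ i, (1 + Polynomial.C (a i) * Polynomial.X)).coeff k = esymmAt a k := by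
  rw [Finset.prod_one_add, Polynomial.finsetSum_coeff, esymmAt_eq_sum, Finset.powersetCard_eq_filter,
    Finset.sum_filter]
  refine Finset.sum_congr rfl fun t _ => ?_
  rw [Finset.prod_mul_distrib, Finset.prod_const, ← map_prod, Polynomial.coeff_C_mul_X_pow]
  simp only [eq_comm]

theorem prod_X_sub_C_eq_sum_esymmAt (a : Fin n → R) :
    ∏ i, (Polynomial.X - Polynomial.C (a i)) =
      ∑ j ∈ Finset.range (n + 1),
        (-1) ^ j * (Polynomial.C (esymmAt a j) * Polynomial.X ^ (n - j)) := by
  have h := Multiset.prod_X_sub_X_eq_sum_esymm (Finset.univ.val.map a)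
  rw [Multiset.map_map, Multiset.card_map, Finset.card_val, Finset.card_univ,
    Fintype.card_fin] at h
  refine Eq.trans h (Finset.sum_congr rfl fun j _ => ?_)
  rw [esymmAt, aeval_esymm_eq_multiset_esymm]

/-- Coefficients of ∏(1 - a_i x) · ∏(1 + a_i x). The point is that the right side sees only the
squares a_i². -/
theorem sum_esymmAt_mul_esymmAt (a : Fin n → R) (m : ℕ) :
    ∑ j ∈ Finset.range (m + 1), (-1) ^ j * esymmAt a j * esymmAt a (m - j) =
      (∏ i, (1 - Polynomial.C (a i ^ 2) * Polynomial.X ^ 2)).coeff m := by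
  have h : ∏ i, (1 - Polynomial.C (a i ^ 2) * Polynomial.X ^ 2) =
      (∏ i, (1 + Polynomial.C (-a i) * Polynomial.X)) *
        ∏ i, (1 + Polynomial.C (a i) * Polynomial.X) := by
    rw [← Finset.prod_mul_distrib]
    refine Finset.prod_congr rfl fun i _ => ?_
    rw [Polynomial.C_neg, Polynomial.C_pow]
    ring
  rw [h, Polynomial.coeff_mul, Finset.Nat.sum_antidiagonal_eq_sum_range_succ_mk]
  refine Finset.sum_congr rfl fun j _ => ?_
  rw [coeff_prod_one_add, coeff_prod_one_add, esymmAt_neg]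

/-- Substitute E = e + 2f in the hypothesis. The two cross sums coincide under j ↦ 2k - j, which
preserves the sign since 2k is even, so everything left is 4 times the desired sum. -/
theorem sum_halves_eq_zero [IsDomain R] [CharZero R] {E e f : ℕ → R}
    (hE : ∀ i, E i = e i + 2 * f i) (h0 : f 0 = 0) (k : ℕ)
    (h : ∑ j ∈ Finset.range (2 * k + 1), (-1) ^ j * E j * E (2 * k - j) =
      ∑ j ∈ Finset.range (2 * k + 1), (-1) ^ j * e j * e (2 * k - j)) :
    ∑ j ∈ Finset.Icc 1 (2 * k), (-1) ^ j * f j * (f (2 * k - j) + e (2 * k - j)) = 0 := by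
  have hIcc : ∑ j ∈ Finset.Icc 1 (2 * k), (-1) ^ j * f j * (f (2 * k - j) + e (2 * k - j)) =
      ∑ j ∈ Finset.range (2 * k + 1), (-1) ^ j * f j * (f (2 * k - j) + e (2 * k - j)) := by
    rw [Finset.sum_range_eq_add_Ico _ (by omega), h0]
    simp only [mul_zero, zero_mul, zero_add]
    rfl
  have hrefl : ∑ j ∈ Finset.range (2 * k + 1), (-1) ^ j * e j * f (2 * k - j) =
      ∑ j ∈ Finset.range (2 * k + 1), (-1) ^ j * f j * e (2 * k - j) := by
    rw [← Finset.sum_range_reflect]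
    refine Finset.sum_congr rfl fun j hj => ?_
    have hj' : j ≤ 2 * k := Nat.lt_succ_iff.1 (Finset.mem_range.1 hj)
    have h1 : 2 * k + 1 - 1 - j = 2 * k - j := by omega
    have h2 : 2 * k - (2 * k - j) = j := by omega
    have h3 : (-1 : R) ^ (2 * k - j) = (-1) ^ j := by
      have h4 : (-1 : R) ^ (2 * k - j) * (-1) ^ j = 1 := by
        rw [← pow_add, Nat.sub_add_cancel hj', pow_mul, neg_one_sq, one_pow]
      have h5 : (-1 : R) ^ j * (-1) ^ j = 1 := by rw [← mul_pow, neg_mul_neg, one_mul, one_pow]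
      linear_combination (-1 : R) ^ j * h4 - (-1 : R) ^ (2 * k - j) * h5
    rw [h1, h2, h3]
    ring
  have hexp : ∑ j ∈ Finset.range (2 * k + 1), (-1) ^ j * E j * E (2 * k - j) =
      ∑ j ∈ Finset.range (2 * k + 1), (-1) ^ j * e j * e (2 * k - j) +
      2 * ∑ j ∈ Finset.range (2 * k + 1), (-1) ^ j * e j * f (2 * k - j) +
      2 * ∑ j ∈ Finset.range (2 * k + 1), (-1) ^ j * f j * e (2 * k - j) +
      4 * ∑ j ∈ Finset.range (2 * k + 1), (-1) ^ j * f j * f (2 * k - j) := by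
    simp only [Finset.mul_sum, ← Finset.sum_add_distrib, hE]
    refine Finset.sum_congr rfl fun j _ => ?_
    ring
  have hs : ∑ j ∈ Finset.range (2 * k + 1), (-1) ^ j * f j * (f (2 * k - j) + e (2 * k - j)) =
      ∑ j ∈ Finset.range (2 * k + 1), (-1) ^ j * f j * f (2 * k - j) +
      ∑ j ∈ Finset.range (2 * k + 1), (-1) ^ j * f j * e (2 * k - j) := by
    rw [← Finset.sum_add_distrib]
    exact Finset.sum_congr rfl fun j _ => mul_add _ _ _
  rw [hIcc, hs]
  rw [hexp, hrefl] at h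
  have h4 : (4 : R) ≠ 0 := by norm_num
  refine mul_left_cancel₀ h4 ?_
  linear_combination h

end ElementarySymmetric

/-! ### Evaluation at vertices: relations and edge conditions -/

section Evaluation
variable {n : ℕ}

/-- The values `w(t_1), …, w(t_n)` of the functions `τ_i` at a vertex. -/
noncomputable def tauAt (w : weylGroup (rootsB n)) (i : Fin n) : HBT n := toHBT (w.1 (tBasis i))

theorem tauAt_eq_or_neg (w : weylGroup (rootsB n)) :
    ∃ σ : Equiv.Perm (Fin n), ∀ i, tauAt w i = X (σ i) ∨ tauAt w i = -X (σ i) := by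
  obtain ⟨σ, hσ⟩ := exists_signed_perm w
  refine ⟨σ, fun i => (hσ i).imp (fun h => ?_) fun h => ?_⟩
  · rw [tauAt, h, toHBT_tBasis]
  · rw [tauAt, h, toHBT_neg, toHBT_tBasis]

/-- Signs disappear modulo 2, leaving a permutation of the variables. -/
theorem two_dvd_esymmAt_sub (w : weylGroup (rootsB n)) (k : ℕ) :
    2 ∣ esymmAt (tauAt w) k - esymmAt (X : Fin n → HBT n) k := by
  obtain ⟨σ, hσ⟩ := tauAt_eq_or_neg w
  rw [← Ideal.mem_span_singleton, ← Ideal.Quotient.eq, map_esymmAt, map_esymmAt,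
    ← esymmAt_perm (fun i => Ideal.Quotient.mk _ (X i)) σ]
  congr 1
  funext i
  rcases hσ i with h | h
  · rw [h]
  · rw [h, Ideal.Quotient.eq, Ideal.mem_span_singleton]
    exact ⟨-X (σ i), by ring⟩

/-- The values of `f_k = (e_k(τ) - e_k(t)) / 2`. -/
noncomputable def halfDiff (w : weylGroup (rootsB n)) (k : ℕ) : HBT n :=
  (two_dvd_esymmAt_sub w k).choose

theorem two_mul_halfDiff (w : weylGroup (rootsB n)) (k : ℕ) :
    2 * halfDiff w k = esymmAt (tauAt w) k - esymmAt (X : Fin n → HBT n) k :=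
  (two_dvd_esymmAt_sub w k).choose_spec.symm

theorem halfDiff_zero (w : weylGroup (rootsB n)) : halfDiff w 0 = 0 := by
  have h := two_mul_halfDiff w 0
  rw [esymmAt_zero, esymmAt_zero, sub_self] at h
  exact (mul_eq_zero.1 h).resolve_left two_ne_zero

theorem halfDiff_of_lt (w : weylGroup (rootsB n)) {k : ℕ} (hk : n < k) : halfDiff w k = 0 := by
  have h := two_mul_halfDiff w k
  rw [esymmAt_of_lt _ hk, esymmAt_of_lt _ hk, sub_self] at h
  exact (mul_eq_zero.1 h).resolve_left two_ne_zero

/-- Evaluation of the generators at a vertex. -/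
noncomputable def genAt (w : weylGroup (rootsB n)) : Gen n → HBT n
  | .tau i => tauAt w i
  | .t i => X i
  | .f i => halfDiff w (i + 1)

/-- Evaluation of a polynomial in the generators at a vertex. -/
noncomputable def evalAt (w : weylGroup (rootsB n)) : PolyB n →ₐ[ℤ] HBT n := aeval (genAt w)

@[simp] theorem evalAt_tau (w : weylGroup (rootsB n)) (i : Fin n) :
    evalAt w (X (.tau i)) = tauAt w i := by
  simp [evalAt, genAt]

@[simp] theorem evalAt_t (w : weylGroup (rootsB n)) (i : Fin n) :
    evalAt w (X (.t i)) = X i := by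
  simp [evalAt, genAt]

@[simp] theorem evalAt_f (w : weylGroup (rootsB n)) (i : Fin n) :
    evalAt w (X (.f i)) = halfDiff w (i + 1) := by
  simp [evalAt, genAt]

@[simp] theorem evalAt_rename_t (w : weylGroup (rootsB n)) (p : HBT n) :
    evalAt w (rename Gen.t p) = p := by
  rw [evalAt, aeval_rename]
  exact aeval_X_left_apply p

theorem evalAt_eTau (w : weylGroup (rootsB n)) (k : ℕ) :
    evalAt w (eTau n k) = esymmAt (tauAt w) k := by
  rw [evalAt, eTau, aeval_rename]
  rfl

theorem evalAt_eT (w : weylGroup (rootsB n)) (k : ℕ) :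
    evalAt w (eT n k) = esymmAt (X : Fin n → HBT n) k := by
  rw [evalAt, eT, aeval_rename]
  rfl

theorem evalAt_fVar (w : weylGroup (rootsB n)) (k : ℕ) :
    evalAt w (fVar n k) = halfDiff w k := by
  cases k with
  | zero => rw [halfDiff_zero]; simp [fVar]
  | succ k =>
    rw [fVar]
    split_ifs with h
    · rw [evalAt_f]
    · rw [halfDiff_of_lt w (by omega), map_zero]

/-- The linear relations define the f_i; the quadratic ones hold because the squares τ_i² are a
permutation of the t_i². -/
theorem idealB_le_ker (w : weylGroup (rootsB n)) : idealB n ≤ RingHom.ker (evalAt w) := by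
  rw [idealB, Ideal.span_le]
  rintro p (⟨i, -, rfl⟩ | ⟨k, -, rfl⟩)
  · rw [SetLike.mem_coe, RingHom.mem_ker, map_add, map_sub, map_mul, map_ofNat, evalAt_fVar,
      evalAt_eTau, evalAt_eT, two_mul_halfDiff]
    ring
  · rw [SetLike.mem_coe, RingHom.mem_ker, map_sum]
    simp only [map_mul, map_add, map_pow, map_neg, map_one, evalAt_fVar, evalAt_eT]
    refine sum_halves_eq_zero (E := esymmAt (tauAt w)) (e := esymmAt (X : Fin n → HBT n))
      (f := halfDiff w) (fun i => ?_) (halfDiff_zero w) k ?_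
    · rw [two_mul_halfDiff]
      ring
    · rw [sum_esymmAt_mul_esymmAt, sum_esymmAt_mul_esymmAt]
      obtain ⟨σ, hσ⟩ := tauAt_eq_or_neg w
      rw [← Equiv.prod_comp σ fun i =>
        (1 - Polynomial.C ((X i : HBT n) ^ 2) * Polynomial.X ^ 2)]
      refine congrArg (fun P : Polynomial (HBT n) => P.coeff (2 * k))
        (Finset.prod_congr rfl fun i _ => ?_)
      rcases hσ i with h | h
      · rw [h]
      · rw [h, neg_sq]

/-- Roots have squared length 1 or 2, so the coefficient 2⟨x,α⟩/⟨α,α⟩ is integral. -/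
theorem IsReflection.exists_apply_eq {α : H2 n} (hα : α ∈ rootsB n) {s : H2 n ≃ₗ[ℤ] H2 n}
    (hs : IsReflection α s) (x : H2 n) : ∃ c : ℤ, s x = x - c • α := by
  have h2 : (α ⬝ᵥ α) ∣ 2 := by
    rcases hα with ⟨i, j, hij, h⟩ | ⟨k, h⟩
    · rcases h with rfl | rfl | rfl | rfl <;> simp [tBasis, hij.ne, hij.ne']
    · rcases h with rfl | rfl <;> simp [tBasis]
  obtain ⟨c, hc⟩ := h2
  refine ⟨c * (x ⬝ᵥ α), smul_right_injective (H2 n) (rootsB_dotProduct_self_ne_zero hα) ?_⟩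
  change (α ⬝ᵥ α) • s x = (α ⬝ᵥ α) • (x - (c * (x ⬝ᵥ α)) • α)
  rw [hs x, smul_sub, smul_smul, ← mul_assoc, ← hc]

theorem prime_toHBT_apply_root (w : weylGroup (rootsB n)) {α : H2 n} (hα : α ∈ rootsB n) :
    Prime (toHBT (w.1 α)) := by
  have h1 : ∃ b, b ⬝ᵥ b = 1 ∧ α ⬝ᵥ b = 1 := by
    rcases hα with ⟨i, j, hij, h⟩ | ⟨k, h⟩
    · rcases h with rfl | rfl | rfl | rfl
      · exact ⟨tBasis i, by simp [tBasis], by simp [tBasis, hij.ne]⟩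
      · exact ⟨-tBasis i, by simp [tBasis], by simp [tBasis, hij.ne]⟩
      · exact ⟨tBasis i, by simp [tBasis], by simp [tBasis, hij.ne]⟩
      · exact ⟨-tBasis i, by simp [tBasis], by simp [tBasis, hij.ne]⟩
    · rcases h with rfl | rfl
      · exact ⟨tBasis k, by simp [tBasis], by simp [tBasis]⟩
      · exact ⟨-tBasis k, by simp [tBasis], by simp [tBasis]⟩
  obtain ⟨b, hb, hαb⟩ := h1
  refine prime_toHBT_of_dotProduct (a := w.1 b) ?_ ?_
  · rw [weylGroup_dotProduct w.2, hb]
  · rw [weylGroup_dotProduct w.2, hαb]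

/-- Modulo the label, the evaluations at the two ends are ring homomorphisms, so only generators
need checking. For f_i the label divides twice the difference; being prime and not dividing 2, it
divides the difference. -/
theorem toHBT_dvd_evalAt_sub {w w' : weylGroup (rootsB n)} {α : H2 n} (hα : α ∈ rootsB n)
    {s : H2 n ≃ₗ[ℤ] H2 n} (hs : IsReflection α s) (hw' : w'.1 = w.1 * s) (p : PolyB n) :
    toHBT (w.1 α) ∣ evalAt w p - evalAt w' p := by
  let q := Ideal.Quotient.mkₐ ℤ (Ideal.span {toHBT (w.1 α)})
  have hq : ∀ a b, q a = q b ↔ toHBT (w.1 α) ∣ a - b := fun a b =>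
    (Ideal.Quotient.eq).trans Ideal.mem_span_singleton
  have htau : ∀ i, q (tauAt w i) = q (tauAt w' i) := by
    intro i
    obtain ⟨c, hc⟩ := hs.exists_apply_eq hα (tBasis i)
    refine (hq _ _).2 ⟨C c, ?_⟩
    rw [tauAt, tauAt, hw', LinearEquiv.mul_apply, hc, map_sub, map_smul,
      toHBT_sub, toHBT_smul, smul_eq_C_mul]
    ring
  have h : q.comp (evalAt w) = q.comp (evalAt w') := by
    refine MvPolynomial.algHom_ext fun g => ?_
    rw [AlgHom.comp_apply, AlgHom.comp_apply]
    cases g with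
    | tau i => rw [evalAt_tau, evalAt_tau, htau]
    | t i => rw [evalAt_t, evalAt_t]
    | f i =>
      rw [evalAt_f, evalAt_f, hq]
      have h1 : q (esymmAt (tauAt w) (i + 1)) = q (esymmAt (tauAt w') (i + 1)) := by
        rw [map_esymmAt, map_esymmAt]
        simp only [htau]
      have h2 : esymmAt (tauAt w) (i + 1) - esymmAt (tauAt w') (i + 1) =
          2 * (halfDiff w (i + 1) - halfDiff w' (i + 1)) := by
        rw [mul_sub, two_mul_halfDiff, two_mul_halfDiff]
        ring
      rw [hq, h2] at h1
      exact ((prime_toHBT_apply_root w hα).dvd_or_dvd h1).resolve_left (not_toHBT_dvd_two _)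
  exact (hq _ _).1 (AlgHom.congr_fun h p)

end Evaluation

/-! ### Surjectivity by interpolation over the values of w(t_m) -/

section Surjectivity
variable {n : ℕ}

/-- The vertices agreeing with `w₀` on the basis vectors of index at least `m`. -/
def agreeFrom (w₀ : weylGroup (rootsB n)) (m : ℕ) : Set (weylGroup (rootsB n)) :=
  {w | ∀ j : Fin n, m ≤ j → w.1 (tBasis j) = w₀.1 (tBasis j)}

/-- The divisibility conditions along the edges joining vertices of `S`. -/
def IsGKMOn (S : Set (weylGroup (rootsB n))) (h : weylGroup (rootsB n) → HBT n) : Prop :=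
  ∀ w ∈ S, ∀ w' ∈ S, ∀ α ∈ rootsB n, ∀ s : H2 n ≃ₗ[ℤ] H2 n, IsReflection α s →
    w'.1 = w.1 * s → toHBT (w.1 α) ∣ h w - h w'

theorem IsGKMOn.sub_evalAt {S : Set (weylGroup (rootsB n))} {h : weylGroup (rootsB n) → HBT n}
    (hh : IsGKMOn S h) (p : PolyB n) : IsGKMOn S fun w => h w - evalAt w p := by
  intro w hw w' hw' α hα s hs hws
  have := dvd_sub (hh w hw w' hw' α hα s hs hws) (toHBT_dvd_evalAt_sub hα hs hws p)
  rwa [sub_sub_sub_comm] at this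

theorem dotProduct_eq_zero_of_ne {a b : H2 n} (ha : a ⬝ᵥ a = 1) (hb : b ⬝ᵥ b = 1) (h : b ≠ a)
    (h' : b ≠ -a) : b ⬝ᵥ a = 0 := by
  obtain ⟨k, rfl | rfl⟩ := exists_eq_tBasis_or_neg ha <;>
  obtain ⟨l, rfl | rfl⟩ := exists_eq_tBasis_or_neg hb <;>
  · have hlk : l ≠ k := by
      rintro rfl
      simp at h h'
    simp [tBasis_dotProduct_of_ne hlk]

/-- The label of the edge along which `w t_m` changes from `a` to `b`. -/
def edgeLabel (a b : H2 n) : H2 n := if b = -a then a else a - b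

theorem edgeLabel_dotProduct {a b : H2 n} (ha : a ⬝ᵥ a = 1) (hb : b ⬝ᵥ b = 1) (h : b ≠ a) :
    edgeLabel a b ⬝ᵥ a = 1 := by
  rw [edgeLabel]
  split_ifs with h'
  · exact ha
  · rw [sub_dotProduct, ha, dotProduct_eq_zero_of_ne ha hb h h', sub_zero]

theorem edgeLabel_injOn {a : H2 n} {T : Set (H2 n)} (hT : ∀ b ∈ T, b ≠ 0) :
    Set.InjOn (edgeLabel a) T := by
  intro b hb b' hb' h
  rw [edgeLabel, edgeLabel] at h
  split_ifs at h with h1 h2 h2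
  · rw [h1, h2]
  · exact absurd (sub_eq_self.1 h.symm) (hT b' hb')
  · exact absurd (by simpa using h) (hT b hb)
  · simpa using h

theorem dotProduct_self_eq_one_of_tBasis (w : weylGroup (rootsB n)) (k : Fin n) :
    w.1 (tBasis k) ⬝ᵥ w.1 (tBasis k) = 1 := by
  rw [weylGroup_dotProduct w.2, tBasis_dotProduct_self]

/-- Unit vectors orthogonal to `w t_j` for `j > m` are of the form `± w t_i` with `i ≤ m`. -/
theorem exists_le_of_orthogonal (w : weylGroup (rootsB n)) {m : Fin n} {b : H2 n}
    (hb : b ⬝ᵥ b = 1) (hbj : ∀ j, m < j → b ⬝ᵥ w.1 (tBasis j) = 0) :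
    ∃ i ≤ m, b = w.1 (tBasis i) ∨ b = -w.1 (tBasis i) := by
  obtain ⟨c, rfl⟩ := w.1.surjective b
  rw [weylGroup_dotProduct w.2] at hb
  simp only [weylGroup_dotProduct w.2] at hbj
  obtain ⟨i, hi⟩ := exists_eq_tBasis_or_neg hb
  refine ⟨i, ?_, ?_⟩
  · by_contra hlt
    have h0 := hbj i (not_le.1 hlt)
    rcases hi with rfl | rfl <;> simp [tBasis_dotProduct_self] at h0
  · rcases hi with rfl | rfl
    · exact Or.inl rfl
    · exact Or.inr (map_neg _ _)

theorem IsReflection.apply_eq_self {α : H2 n} {s : H2 n ≃ₗ[ℤ] H2 n} (hs : IsReflection α s)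
    (hα : α ∈ rootsB n) {x : H2 n} (hx : x ⬝ᵥ α = 0) : s x = x := by
  refine smul_right_injective (H2 n) (rootsB_dotProduct_self_ne_zero hα) ?_
  change (α ⬝ᵥ α) • s x = (α ⬝ᵥ α) • x
  rw [hs x, hx, mul_zero, zero_smul, sub_zero]

/-- Every admissible value b is reached from `w` along one edge that stays in the subgraph. The root
is t_m if b = -w(t_m), and t_m - w⁻¹(b) otherwise; both are orthogonal to t_j for j > m. -/
theorem exists_neighbor {w₀ w : weylGroup (rootsB n)} {m : Fin n}
    (hw : w ∈ agreeFrom w₀ (m + 1)) {b : H2 n} (hb : b ⬝ᵥ b = 1)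
    (hbj : ∀ j, m < j → b ⬝ᵥ w₀.1 (tBasis j) = 0) (hne : b ≠ w.1 (tBasis m)) :
    ∃ α ∈ rootsB n, ∃ s, IsReflection α s ∧ ∃ w' ∈ agreeFrom w₀ (m + 1),
      w'.1 = w.1 * s ∧ w'.1 (tBasis m) = b ∧ w.1 α = edgeLabel (w.1 (tBasis m)) b := by
  have key : ∀ α ∈ rootsB n, (∀ j, m < j → tBasis j ⬝ᵥ α = 0) →
      w.1 α = edgeLabel (w.1 (tBasis m)) b →
      (∀ s, IsReflection α s → w.1 (s (tBasis m)) = b) →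
      ∃ α ∈ rootsB n, ∃ s, IsReflection α s ∧ ∃ w' ∈ agreeFrom w₀ (m + 1),
        w'.1 = w.1 * s ∧ w'.1 (tBasis m) = b ∧ w.1 α = edgeLabel (w.1 (tBasis m)) b := by
    intro α hα horth hlab hsb
    obtain ⟨s, hs, -⟩ := existsUnique_isReflection_of_mem_rootsB hα
    refine ⟨α, hα, s, hs, ⟨w.1 * s, mul_mem w.2 (reflection_mem_weylGroup hα hs)⟩, ?_, rfl, ?_,
      hlab⟩
    · intro j hj
      change w.1 (s (tBasis j)) = _
      rw [hs.apply_eq_self hα (horth j (Fin.lt_def.2 hj)), hw j hj]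
    · exact hsb s hs
  have hbj' : ∀ j, m < j → b ⬝ᵥ w.1 (tBasis j) = 0 := fun j hj => by
    rw [hw j hj, hbj j hj]
  obtain ⟨i, him, hi⟩ := exists_le_of_orthogonal w hb hbj'
  by_cases hneg : b = -w.1 (tBasis m)
  · refine key (tBasis m) (tBasis_mem_rootsB m)
      (fun j hj => tBasis_dotProduct_of_ne hj.ne') (by rw [edgeLabel, if_pos hneg]) ?_
    intro s hs
    have h := hs (tBasis m)
    rw [tBasis_dotProduct_self, one_smul, one_smul] at h
    rw [h, hneg, ← map_neg]
    congr 1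
    module
  · have himne : i ≠ m := by
      rintro rfl
      exact hi.elim hne hneg
    obtain ⟨c, hcb, hc⟩ : ∃ c, w.1 c = b ∧ (c = tBasis i ∨ c = -tBasis i) := by
      rcases hi with rfl | rfl
      · exact ⟨_, rfl, Or.inl rfl⟩
      · exact ⟨_, map_neg _ _, Or.inr rfl⟩
    have hroot : tBasis m - c ∈ rootsB n := by
      rcases hc with rfl | rfl
      · exact tBasis_sub_mem_rootsB himne.symm
      · rw [sub_neg_eq_add]
        exact tBasis_add_mem_rootsB himne.symm
    have hcc : c ⬝ᵥ c = 1 := by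
      rcases hc with rfl | rfl <;> simp [tBasis_dotProduct_self]
    have hcj : ∀ j, j ≠ i → tBasis j ⬝ᵥ c = 0 := by
      intro j hj
      rcases hc with rfl | rfl <;> simp [tBasis_dotProduct_of_ne hj]
    refine key (tBasis m - c) hroot (fun j hj => ?_) ?_ ?_
    · rw [dotProduct_sub, tBasis_dotProduct_of_ne hj.ne', hcj j (him.trans_lt hj).ne', sub_zero]
    · rw [edgeLabel, if_neg hneg, map_sub, hcb]
    · intro s hs
      have hm := hcj m himne.symm
      have h1 : tBasis m ⬝ᵥ (tBasis m - c) = 1 := by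
        rw [dotProduct_sub, tBasis_dotProduct_self, hm, sub_zero]
      have h2 : (tBasis m - c) ⬝ᵥ (tBasis m - c) = 2 := by
        rw [sub_dotProduct, h1, dotProduct_sub, dotProduct_comm, hm, hcc]
        norm_num
      have h := hs (tBasis m)
      rw [h1, h2, mul_one, ← smul_sub, sub_sub_cancel] at h
      rw [smul_right_injective (H2 n) (two_ne_zero (α := ℤ)) h, hcb]

theorem smul_divByMonic {R : Type*} [CommRing R] [Nontrivial R] (c : R) (p : Polynomial R)
    {q : Polynomial R} (hq : q.Monic) : (c • p) /ₘ q = c • (p /ₘ q) := by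
  refine (Polynomial.div_modByMonic_unique _ (c • (p %ₘ q)) hq ⟨?_, ?_⟩).1
  · rw [mul_smul_comm, ← smul_add, Polynomial.modByMonic_add_div]
  · exact (Polynomial.degree_smul_le _ _).trans_lt (Polynomial.degree_modByMonic_lt _ hq)

/-- This is where the f_i are indispensable. At `w`, twice F is ∏(x - τ_j(w)) - ∏(x - τ_j(w₀)), and
both products contain the factor P = ∏_{j>m}(x - τ_j(w₀)). Division by the monic P commutes with
evaluation, so one polynomial quotient serves all `w`. -/
theorem exists_half_multiplier (w₀ : weylGroup (rootsB n)) (m : Fin n) :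
    ∃ M : PolyB n, ∀ w ∈ agreeFrom w₀ (m + 1),
      2 * evalAt w M = ∏ k ∈ Finset.Iic m, (tauAt w m - tauAt w₀ k) := by
  let F : Polynomial (PolyB n) := ∑ j ∈ Finset.range (n + 1), (-1) ^ j *
    (Polynomial.C (fVar n j - rename Gen.t (halfDiff w₀ j)) * Polynomial.X ^ (n - j))
  let P : Polynomial (PolyB n) :=
    ∏ j ∈ Finset.Ioi m, (Polynomial.X - Polynomial.C (rename Gen.t (tauAt w₀ j)))
  have hP : P.Monic := Polynomial.monic_prod_of_monic _ _ fun j _ => Polynomial.monic_X_sub_C _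
  -- At x = τ_m the product of the x - τ_j(w) over j ≤ m vanishes and the other enters negatively,
  -- hence the sign.
  refine ⟨-(F /ₘ P).eval (X (.tau m)), fun w hw => ?_⟩
  let φ : PolyB n →+* HBT n := (evalAt w).toRingHom
  have hφ : ∀ p, φ p = evalAt w p := fun _ => rfl
  have hPφ : P.map φ = ∏ j ∈ Finset.Ioi m, (Polynomial.X - Polynomial.C (tauAt w₀ j)) := by
    simp [P, Polynomial.map_prod, hφ]
  have hsplit : ∀ v : Fin n → HBT n, ∏ i, (Polynomial.X - Polynomial.C (v i)) =
      (∏ j ∈ Finset.Ioi m, (Polynomial.X - Polynomial.C (v j))) *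
        ∏ j ∈ Finset.Iic m, (Polynomial.X - Polynomial.C (v j)) := by
    intro v
    rw [mul_comm, ← Finset.prod_union]
    · refine Finset.prod_congr ?_ fun _ _ => rfl
      ext i
      simp [le_or_gt]
    · rw [Finset.disjoint_left]
      intro i hi hi'
      exact absurd (Finset.mem_Iic.1 hi) (not_le.2 (Finset.mem_Ioi.1 hi'))
  have hF : (2 : HBT n) • F.map φ =
      P.map φ * (∏ j ∈ Finset.Iic m, (Polynomial.X - Polynomial.C (tauAt w j)) -
        ∏ j ∈ Finset.Iic m, (Polynomial.X - Polynomial.C (tauAt w₀ j))) := by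
    have h1 : ∏ j ∈ Finset.Ioi m, (Polynomial.X - Polynomial.C (tauAt w j)) =
        ∏ j ∈ Finset.Ioi m, (Polynomial.X - Polynomial.C (tauAt w₀ j)) := by
      refine Finset.prod_congr rfl fun j hj => ?_
      rw [tauAt, tauAt, hw j (Fin.lt_def.1 (Finset.mem_Ioi.1 hj))]
    rw [hPφ, mul_sub, ← hsplit, ← h1, ← hsplit, prod_X_sub_C_eq_sum_esymmAt,
      prod_X_sub_C_eq_sum_esymmAt, ← Finset.sum_sub_distrib, Polynomial.map_sum,
      two_smul, ← Finset.sum_add_distrib]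
    refine Finset.sum_congr rfl fun j _ => ?_
    have h2 : esymmAt (tauAt w) j - esymmAt (tauAt w₀) j =
        (halfDiff w j - halfDiff w₀ j) + (halfDiff w j - halfDiff w₀ j) := by
      linear_combination two_mul_halfDiff w₀ j - two_mul_halfDiff w j
    rw [← mul_sub, ← sub_mul, ← Polynomial.C_sub, h2, Polynomial.C_add]
    have h3 : φ (fVar n j - rename Gen.t (halfDiff w₀ j)) = halfDiff w j - halfDiff w₀ j := by
      rw [hφ, map_sub, evalAt_fVar, evalAt_rename_t]
    simp only [Polynomial.map_mul, Polynomial.map_pow, Polynomial.map_neg, Polynomial.map_one,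
      Polynomial.map_C, Polynomial.map_X, h3]
    ring
  have hQ : (2 : HBT n) • (F /ₘ P).map φ =
      ∏ j ∈ Finset.Iic m, (Polynomial.X - Polynomial.C (tauAt w j)) -
        ∏ j ∈ Finset.Iic m, (Polynomial.X - Polynomial.C (tauAt w₀ j)) := by
    rw [Polynomial.map_divByMonic _ hP, ← smul_divByMonic _ _ (hP.map φ), hF,
      Polynomial.mul_divByMonic_cancel_left _ (hP.map φ)]
  have hev := congrArg (Polynomial.eval (tauAt w m)) hQ
  rw [two_smul, Polynomial.eval_add, Polynomial.eval_sub, Polynomial.eval_prod, Polynomial.eval_prod,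
    Finset.prod_eq_zero (Finset.mem_Iic.2 le_rfl) (by simp), zero_sub] at hev
  have hM : evalAt w ((F /ₘ P).eval (X (.tau m))) = ((F /ₘ P).map φ).eval (tauAt w m) := by
    rw [← evalAt_tau, ← hφ, ← hφ, Polynomial.eval_map, Polynomial.eval₂_at_apply]
  rw [map_neg, hM]
  simp only [Polynomial.eval_sub, Polynomial.eval_X, Polynomial.eval_C] at hev
  linear_combination -hev

/-- The label between a and b is a - b, except that for b = -a it is a, half of a - b. -/
theorem mul_prod_edgeLabel (T : Finset (H2 n)) {a : H2 n} :
    (if -a ∈ T then 2 else 1) * ∏ b ∈ T, toHBT (edgeLabel a b) =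
      ∏ b ∈ T, (toHBT a - toHBT b) := by
  have h : ∀ b, b ≠ -a → toHBT (edgeLabel a b) = toHBT a - toHBT b := by
    intro b hb
    rw [edgeLabel, if_neg hb, toHBT_sub]
  split_ifs with hT
  · rw [← Finset.mul_prod_erase _ _ hT, ← Finset.mul_prod_erase T (fun b => toHBT a - toHBT b) hT,
      Finset.prod_congr rfl fun b hb => h b (Finset.ne_of_mem_erase hb), edgeLabel, if_pos rfl,
      toHBT_neg]
    ring
  · rw [one_mul]
    exact Finset.prod_congr rfl fun b hb => h b fun hb' => hT (hb' ▸ hb)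

/-- One Newton step. On the fibre of a, h - p equals D·g with D the product of the labels of the
edges towards T, and g is again a GKM function there, so g comes from some q by `ih`. As M is D on
the fibre and 0 over T, the polynomial p + M q extends p. -/
theorem exists_evalAt_eq_insert {w₀ : weylGroup (rootsB n)} {m : Fin n}
    (ih : ∀ (w₁ : weylGroup (rootsB n)) (g : weylGroup (rootsB n) → HBT n),
      IsGKMOn (agreeFrom w₁ m) g → ∃ p, ∀ w ∈ agreeFrom w₁ m, g w = evalAt w p)
    {T : Finset (H2 n)} (hT : ∀ b ∈ T, b ⬝ᵥ b = 1 ∧ ∀ j, m < j → b ⬝ᵥ w₀.1 (tBasis j) = 0)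
    {a : H2 n} (haT : a ∉ T) {M : PolyB n}
    (hM : ∀ w ∈ agreeFrom w₀ (m + 1), (if -a ∈ T then 2 else 1) * evalAt w M =
      ∏ b ∈ T, (tauAt w m - toHBT b))
    {h : weylGroup (rootsB n) → HBT n} (hh : IsGKMOn (agreeFrom w₀ (m + 1)) h)
    (hp : ∃ p, ∀ w ∈ agreeFrom w₀ (m + 1), w.1 (tBasis m) ∈ T → h w = evalAt w p) :
    ∃ p, ∀ w ∈ agreeFrom w₀ (m + 1), w.1 (tBasis m) ∈ insert a T → h w = evalAt w p := by
  obtain ⟨p, hp⟩ := hp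
  by_cases hex : ∃ w₁ ∈ agreeFrom w₀ (m + 1), w₁.1 (tBasis m) = a
  swap
  · refine ⟨p, fun w hw hwa => hp w hw ((Finset.mem_insert.1 hwa).resolve_left fun h => ?_)⟩
    exact hex ⟨w, hw, h⟩
  obtain ⟨w₁, hw₁, rfl⟩ := hex
  set a := w₁.1 (tBasis m) with ha_def
  have ha : a ⬝ᵥ a = 1 := dotProduct_self_eq_one_of_tBasis w₁ m
  have hc : (if -a ∈ T then 2 else 1 : HBT n) ≠ 0 := by
    split_ifs
    · exact two_ne_zero
    · exact one_ne_zero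
  have hmem : ∀ w, w ∈ agreeFrom w₁ m ↔ w ∈ agreeFrom w₀ (m + 1) ∧ w.1 (tBasis m) = a := by
    intro w
    constructor
    · refine fun hw => ⟨fun j hj => ?_, hw m le_rfl⟩
      rw [hw j (by omega), hw₁ j hj]
    · rintro ⟨hw, hwa⟩ j hj
      rcases hj.eq_or_lt with hj | hj
      · rw [← Fin.ext hj, hwa]
      · rw [hw j hj, hw₁ j hj]
  set D : HBT n := ∏ b ∈ T, toHBT (edgeLabel a b) with hD
  have hMD : ∀ w ∈ agreeFrom w₁ m, evalAt w M = D := by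
    intro w hw
    obtain ⟨hw, hwa⟩ := (hmem w).1 hw
    refine mul_left_cancel₀ hc ?_
    rw [hM w hw, hD, mul_prod_edgeLabel, tauAt, hwa]
  have hne : ∀ b ∈ T, b ≠ a := fun b hb hba => haT (hba ▸ hb)
  have hdot : ∀ b ∈ T, edgeLabel a b ⬝ᵥ a = 1 := fun b hb =>
    edgeLabel_dotProduct ha (hT b hb).1 (hne b hb)
  have hh' := hh.sub_evalAt p
  -- Membership sits under the existential so that choice yields a function on all vertices; its
  -- values off the fibre are irrelevant.
  have hdvd : ∀ w, ∃ g, w ∈ agreeFrom w₁ m → h w - evalAt w p = D * g := by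
    intro w
    by_cases hw : w ∈ agreeFrom w₁ m
    swap
    · exact ⟨0, fun h => absurd h hw⟩
    obtain ⟨hw0, hwa⟩ := (hmem w).1 hw
    have hDd : D ∣ h w - evalAt w p := by
      refine prod_toHBT_dvd ha hdot (edgeLabel_injOn ?_) fun b hb => ?_
      · rintro b hb rfl
        simpa using (hT 0 hb).1
      · obtain ⟨α, hα, s, hs, w', hw', hws, hwb, hlab⟩ :=
          exists_neighbor hw0 (hT b hb).1 (hT b hb).2 (hwa ▸ hne b hb)
        have h1 := hh' w hw0 w' hw' α hα s hs hws
        simp only at h1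
        rw [hlab, hwa, hp w' hw' (hwb ▸ hb), sub_self, sub_zero] at h1
        exact h1
    obtain ⟨g, hg⟩ := hDd
    exact ⟨g, fun _ => hg⟩
  choose g hg using hdvd
  obtain ⟨q, hq⟩ := ih w₁ g (by
    intro w hw w' hw' α hα s hs hws
    have h1 := hh' w ((hmem w).1 hw).1 w' ((hmem w').1 hw').1 α hα s hs hws
    simp only at h1
    rw [hg w hw, hg w' hw', ← mul_sub] at h1
    refine dvd_of_dvd_prod_toHBT_mul hdot ?_ (prime_toHBT_apply_root w hα) h1
    rw [← ((hmem w).1 hw).2, weylGroup_dotProduct w.2]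
    -- An edge inside the fibre does not move t_m, so its root is orthogonal to t_m and its label
    -- vanishes at a, as cancelling D requires.
    have h2 : s (tBasis m) = tBasis m := by
      have h3 := ((hmem w').1 hw').2
      rw [hws, LinearEquiv.mul_apply, ← ((hmem w).1 hw).2] at h3
      exact w.1.injective h3
    have h4 := hs (tBasis m)
    rw [h2, eq_comm, sub_eq_self, smul_eq_zero] at h4
    rcases h4 with h4 | rfl
    · rw [dotProduct_comm]
      omega
    · simp)
  refine ⟨p + M * q, fun w hw hwa => ?_⟩
  rw [map_add, map_mul]
  rcases Finset.mem_insert.1 hwa with hwa | hwT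
  · have hw1 := (hmem w).2 ⟨hw, hwa⟩
    rw [hMD w hw1, ← hq w hw1, ← hg w hw1]
    ring
  · have h0 : evalAt w M = 0 := by
      refine (mul_eq_zero.1 ?_).resolve_left hc
      rw [hM w hw]
      exact Finset.prod_eq_zero hwT (sub_self _)
    rw [h0, zero_mul, add_zero, hp w hw hwT]

/-- The order of the values matters. The u_k come first, when no opposite value is present and plain
products serve as multipliers; the -u_k follow, each needing exactly one factor 2 removed. -/
theorem exists_evalAt_eq_succ {m : Fin n}
    (ih : ∀ (w₁ : weylGroup (rootsB n)) (g : weylGroup (rootsB n) → HBT n),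
      IsGKMOn (agreeFrom w₁ m) g → ∃ p, ∀ w ∈ agreeFrom w₁ m, g w = evalAt w p)
    (w₀ : weylGroup (rootsB n)) {h : weylGroup (rootsB n) → HBT n}
    (hh : IsGKMOn (agreeFrom w₀ (m + 1)) h) :
    ∃ p, ∀ w ∈ agreeFrom w₀ (m + 1), h w = evalAt w p := by
  let u : Fin n → H2 n := fun k => w₀.1 (tBasis k)
  have huu : ∀ k, u k ⬝ᵥ u k = 1 := dotProduct_self_eq_one_of_tBasis w₀
  have hort : ∀ k l, k ≠ l → u k ⬝ᵥ u l = 0 := fun k l hkl => by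
    rw [weylGroup_dotProduct w₀.2, tBasis_dotProduct_of_ne hkl]
  have hinj : Function.Injective u := by
    intro k l hkl
    by_contra hne
    have := hort k l hne
    rw [hkl, huu] at this
    exact one_ne_zero this
  have hneg : ∀ k l, -u k ≠ u l := by
    intro k l hkl
    have h1 := huu l
    rcases eq_or_ne k l with rfl | hne
    · nth_rw 1 [← hkl] at h1
      rw [neg_dotProduct, huu] at h1
      norm_num at h1
    · nth_rw 1 [← hkl] at h1
      rw [neg_dotProduct, hort k l hne] at h1
      norm_num at h1
  have hadm : ∀ k ≤ m, u k ⬝ᵥ u k = 1 ∧ ∀ j, m < j → u k ⬝ᵥ w₀.1 (tBasis j) = 0 :=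
    fun k hk => ⟨huu k, fun j hj => hort k j (hk.trans_lt hj).ne⟩
  have hadm' : ∀ k ≤ m, -u k ⬝ᵥ -u k = 1 ∧ ∀ j, m < j → -u k ⬝ᵥ w₀.1 (tBasis j) = 0 :=
    fun k hk => ⟨by simpa using huu k, fun j hj => by
      rw [neg_dotProduct, (hadm k hk).2 j hj, neg_zero]⟩
  have heval : ∀ (T : Finset (H2 n)) (w : weylGroup (rootsB n)),
      evalAt w (∏ b ∈ T, (X (.tau m) - rename Gen.t (toHBT b))) =
        ∏ b ∈ T, (tauAt w m - toHBT b) := by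
    intro T w
    simp [map_prod]
  have phase1 : ∀ K ⊆ Finset.Iic m, ∃ p, ∀ w ∈ agreeFrom w₀ (m + 1),
      w.1 (tBasis m) ∈ K.image u → h w = evalAt w p := by
    intro K
    induction K using Finset.induction_on with
    | empty => exact fun _ => ⟨0, by simp⟩
    | insert k K hk hK =>
      intro hsub
      rw [Finset.image_insert]
      refine exists_evalAt_eq_insert ih (M := ∏ b ∈ K.image u,
        (X (.tau m) - rename Gen.t (toHBT b))) ?_ ?_ ?_ hh
        (hK ((Finset.subset_insert _ _).trans hsub))
      · intro b hb
        obtain ⟨l, hl, rfl⟩ := Finset.mem_image.1 hb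
        exact hadm l (Finset.mem_Iic.1 (hsub (Finset.mem_insert_of_mem hl)))
      · intro hmem
        obtain ⟨l, hl, hlk⟩ := Finset.mem_image.1 hmem
        exact hk (hinj hlk ▸ hl)
      · intro w _
        rw [if_neg, one_mul, heval]
        intro hmem
        obtain ⟨l, -, hlk⟩ := Finset.mem_image.1 hmem
        exact hneg k l hlk.symm
  obtain ⟨N, hN⟩ := exists_half_multiplier w₀ m
  have phase2 : ∀ L ⊆ Finset.Iic m, ∃ p, ∀ w ∈ agreeFrom w₀ (m + 1),
      w.1 (tBasis m) ∈ (Finset.Iic m).image u ∪ L.image (fun k => -u k) → h w = evalAt w p := by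
    intro L
    induction L using Finset.induction_on with
    | empty => simpa using phase1 _ subset_rfl
    | insert k L hk hL =>
      intro hsub
      rw [Finset.image_insert, Finset.union_insert]
      refine exists_evalAt_eq_insert ih (M := N * ∏ b ∈ L.image (fun k => -u k),
        (X (.tau m) - rename Gen.t (toHBT b))) ?_ ?_ ?_ hh
        (hL ((Finset.subset_insert _ _).trans hsub))
      · intro b hb
        rcases Finset.mem_union.1 hb with hb | hb
        · obtain ⟨l, hl, rfl⟩ := Finset.mem_image.1 hb
          exact hadm l (Finset.mem_Iic.1 hl)
        · obtain ⟨l, hl, rfl⟩ := Finset.mem_image.1 hb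
          exact hadm' l (Finset.mem_Iic.1 (hsub (Finset.mem_insert_of_mem hl)))
      · intro hmem
        rcases Finset.mem_union.1 hmem with hmem | hmem
        · obtain ⟨l, -, hlk⟩ := Finset.mem_image.1 hmem
          exact hneg k l hlk.symm
        · obtain ⟨l, hl, hlk⟩ := Finset.mem_image.1 hmem
          exact hk (hinj (neg_injective hlk) ▸ hl)
      · intro w hw
        -- The opposite u_k of the new value is already present, so the factor 2 is required; N
        -- absorbs it.
        have hkm : - -u k ∈ (Finset.Iic m).image u ∪ L.image (fun k => -u k) := by
          rw [neg_neg]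
          exact Finset.mem_union_left _ (Finset.mem_image_of_mem u (hsub (Finset.mem_insert_self _ _)))
        rw [if_pos hkm, map_mul, heval, ← mul_assoc, hN w hw, Finset.prod_union,
          Finset.prod_image fun _ _ _ _ h => hinj h]
        · rfl
        · rw [Finset.disjoint_left]
          intro b hb hb'
          obtain ⟨l, -, rfl⟩ := Finset.mem_image.1 hb
          obtain ⟨l', -, hl'⟩ := Finset.mem_image.1 hb'
          exact hneg l' l hl'
  obtain ⟨p, hp⟩ := phase2 _ subset_rfl
  refine ⟨p, fun w hw => hp w hw ?_⟩
  obtain ⟨i, hi, hwi⟩ := exists_le_of_orthogonal w₀ (m := m)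
    (dotProduct_self_eq_one_of_tBasis w m) fun j hj => by
      rw [← hw j (Fin.lt_def.1 hj), weylGroup_dotProduct w.2, tBasis_dotProduct_of_ne hj.ne]
  rw [Finset.mem_union]
  rcases hwi with hwi | hwi
  · exact Or.inl (hwi ▸ Finset.mem_image_of_mem u (Finset.mem_Iic.2 hi))
  · exact Or.inr (hwi ▸ Finset.mem_image_of_mem (fun k => -u k) (Finset.mem_Iic.2 hi))

theorem exists_evalAt_eq_of_isGKMOn {m : ℕ} (hm : m ≤ n) :
    ∀ (w₀ : weylGroup (rootsB n)) (h : weylGroup (rootsB n) → HBT n),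
      IsGKMOn (agreeFrom w₀ m) h → ∃ p, ∀ w ∈ agreeFrom w₀ m, h w = evalAt w p := by
  induction m with
  | zero =>
    intro w₀ h _
    refine ⟨rename Gen.t (h w₀), fun w hw => ?_⟩
    have : w = w₀ := Subtype.ext (linearEquiv_ext_tBasis fun i => hw i (Nat.zero_le _))
    rw [this, evalAt_rename_t]
  | succ m ih =>
    intro w₀ h hh
    exact exists_evalAt_eq_succ (m := ⟨m, hm⟩) (ih (Nat.le_of_succ_le hm)) w₀ hh

/-- Every element of the graph cohomology is a polynomial in the `τ_i`, `t_i` and `f_i`. -/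
theorem exists_evalAt_eq {h : weylGroup (rootsB n) → HBT n} (hh : IsGKMOn Set.univ h) :
    ∃ p, ∀ w, h w = evalAt w p := by
  have huniv : agreeFrom (1 : weylGroup (rootsB n)) n = Set.univ :=
    Set.eq_univ_of_forall fun w j hj => absurd j.2 (not_lt.2 hj)
  obtain ⟨p, hp⟩ := exists_evalAt_eq_of_isGKMOn le_rfl 1 h (huniv ▸ hh)
  exact ⟨p, fun w => hp w (huniv ▸ Set.mem_univ w)⟩

end Surjectivity

/-! ### Spanning the quotient by 2^n n! elements -/

section Spanning
variable {A R : Type*} [CommRing A] [CommRing R] [Algebra A R]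

/-- The submodule `M` is contained in the span of at most `N` elements. -/
def IsSpannedBy (M : Submodule A R) (N : ℕ) : Prop :=
  ∃ s : Finset R, s.card ≤ N ∧ M ≤ Submodule.span A (s : Set R)

section Squarefree
variable {n : ℕ} {f : ℕ → R} {e : ℕ → A}

open scoped Classical in
/-- The quadratic relations reduce every monomial in the `f_i` to squarefree ones. -/
theorem multiset_prod_mem_span (h0 : f 0 = 0) (hlt : ∀ l, n < l → f l = 0)
    (hrel : ∀ k ∈ Finset.Icc 1 n, ∑ j ∈ Finset.Icc 1 (2 * k),
      (-1) ^ j * f j * (f (2 * k - j) + algebraMap A R (e (2 * k - j))) = 0) (s : Multiset ℕ) :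
    (s.map f).prod ∈ Submodule.span A
      (((Finset.Icc 1 n).powerset.image fun T => ∏ i ∈ T, f i : Finset R) : Set R) := by
  set M := Submodule.span A
      (((Finset.Icc 1 n).powerset.image fun T => ∏ i ∈ T, f i : Finset R) : Set R) with hM
  -- Replacing f_k² by f_j f_{2k-j} with j ≠ k lowers this weight, as j² + (2k-j)² > 2k². The
  -- constant 2n² + 1 makes replacement by a single f_j lower it too: 2(2n² + 1 - k²) > 2n² when k ≤
  -- n.
  induction hμ : (s.map fun j => 2 * n ^ 2 + 1 - j ^ 2).sum using Nat.strong_induction_on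
    generalizing s with
  | _ N ih =>
  subst hμ
  by_cases hs : ∀ j ∈ s, j ∈ Finset.Icc 1 n
  swap
  · push Not at hs
    obtain ⟨j, hj, hjn⟩ := hs
    have hfj : f j = 0 := by
      rw [Finset.mem_Icc, not_and_or, not_le, not_le] at hjn
      rcases hjn with hjn | hjn
      · rw [Nat.lt_one_iff.1 hjn, h0]
      · exact hlt j hjn
    rw [Multiset.prod_eq_zero (Multiset.mem_map.2 ⟨j, hj, hfj⟩)]
    exact zero_mem _
  by_cases hnd : s.Nodup
  · refine Submodule.subset_span (Finset.mem_coe.2 (Finset.mem_image.2 ⟨⟨s, hnd⟩, ?_, rfl⟩))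
    exact Finset.mem_powerset.2 fun j hj => hs j hj
  obtain ⟨k, hk⟩ : ∃ k, k ::ₘ k ::ₘ 0 ≤ s := by
    by_contra! h
    exact hnd (Multiset.nodup_iff_le.2 h)
  obtain ⟨r, rfl⟩ := Multiset.le_iff_exists_add.1 hk
  have hkn := Finset.mem_Icc.1 (hs k (by simp))
  have hk2 : k ^ 2 ≤ n ^ 2 := Nat.pow_le_pow_left hkn.2 2
  set p := (r.map f).prod with hp
  set σ := (r.map fun j => 2 * n ^ 2 + 1 - j ^ 2).sum with hσ
  have hsum : ((k ::ₘ k ::ₘ 0 + r).map fun j => 2 * n ^ 2 + 1 - j ^ 2).sum =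
      2 * (2 * n ^ 2 + 1 - k ^ 2) + σ := by
    simp [hσ]
    ring
  have hlin : ∀ j ∈ Finset.Icc 1 (2 * k), f j * p ∈ M := by
    intro j hj
    have hj1 := (Finset.mem_Icc.1 hj).1
    by_cases hjn : n < j
    · rw [hlt j hjn, zero_mul]
      exact zero_mem _
    have h1 := ih _ (by
      rw [hsum, Multiset.map_cons, Multiset.sum_cons, ← hσ]
      have : 1 ≤ j ^ 2 := Nat.one_le_pow _ _ hj1
      omega) (j ::ₘ r) rfl
    rwa [Multiset.map_cons, Multiset.prod_cons] at h1
  have hquad : ∀ j ∈ Finset.Icc 1 (2 * k), j ≠ k → f j * f (2 * k - j) * p ∈ M := by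
    intro j hj hjk
    have hj1 := Finset.mem_Icc.1 hj
    obtain ⟨i, hi⟩ : ∃ i, i = 2 * k - j := ⟨_, rfl⟩
    rw [← hi]
    by_cases hjn : n < j
    · rw [hlt j hjn, zero_mul, zero_mul]
      exact zero_mem _
    by_cases hin : n < i
    · rw [hlt i hin, mul_zero, zero_mul]
      exact zero_mem _
    have hj2 : j ^ 2 ≤ n ^ 2 := Nat.pow_le_pow_left (not_lt.1 hjn) 2
    have hi2 : i ^ 2 ≤ n ^ 2 := Nat.pow_le_pow_left (not_lt.1 hin) 2
    have hij : 2 * k ^ 2 < j ^ 2 + i ^ 2 := by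
      have h2 : (i : ℤ) = 2 * k - j := by omega
      have h3 : (j : ℤ) - k ≠ 0 := by omega
      zify
      rw [h2]
      have := sq_pos_of_ne_zero h3
      linarith [show (j : ℤ) ^ 2 + (2 * k - j) ^ 2 = 2 * k ^ 2 + 2 * (j - k) ^ 2 by ring]
    have h1 := ih _ (by
      rw [hsum, Multiset.map_cons, Multiset.sum_cons, Multiset.map_cons, Multiset.sum_cons, ← hσ]
      omega) (j ::ₘ i ::ₘ r) rfl
    rwa [Multiset.map_cons, Multiset.prod_cons, Multiset.map_cons, Multiset.prod_cons,
      ← mul_assoc] at h1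
  have hterm : ∀ j ∈ Finset.Icc 1 (2 * k), j ≠ k →
      (-1) ^ j * f j * (f (2 * k - j) + algebraMap A R (e (2 * k - j))) * p ∈ M := by
    intro j hj hjk
    have h1 := M.smul_mem ((-1) ^ j) (M.add_mem (hquad j hj hjk)
      (M.smul_mem (e (2 * k - j)) (hlin j hj)))
    convert h1 using 1
    rw [Algebra.smul_def, Algebra.smul_def, map_pow, map_neg, map_one]
    ring
  have hkmem : k ∈ Finset.Icc 1 (2 * k) := Finset.mem_Icc.2 ⟨hkn.1, by omega⟩
  have hr := hrel k (Finset.mem_Icc.2 hkn)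
  rw [← Finset.add_sum_erase _ _ hkmem, show 2 * k - k = k by omega] at hr
  have hrest : (∑ j ∈ (Finset.Icc 1 (2 * k)).erase k,
      (-1) ^ j * f j * (f (2 * k - j) + algebraMap A R (e (2 * k - j)))) * p ∈ M := by
    rw [Finset.sum_mul]
    exact M.sum_mem fun j hj => hterm j (Finset.mem_of_mem_erase hj) (Finset.ne_of_mem_erase hj)
  -- The k-th relation solved for f_k², its term j = k being (-1)^k f_k (f_k + e_k).
  have hfin := M.sub_mem (M.smul_mem (-(-1) ^ k) hrest) (M.smul_mem (e k) (hlin k hkmem))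
  convert hfin using 1
  have hone : ((-1 : R) ^ k) * (-1) ^ k = 1 := by
    rw [← mul_pow, neg_mul_neg, one_mul, one_pow]
  rw [Algebra.smul_def, Algebra.smul_def, map_neg, map_pow, map_neg, map_one]
  simp only [Multiset.cons_add, Multiset.map_cons, Multiset.prod_cons, zero_add, ← hp]
  linear_combination ((-1) ^ k * p) * hr - (f k * f k * p + f k * algebraMap A R (e k) * p) * hone

open scoped Classical in
theorem isSpannedBy_adjoin_range (h0 : f 0 = 0) (hlt : ∀ l, n < l → f l = 0)
    (hrel : ∀ k ∈ Finset.Icc 1 n, ∑ j ∈ Finset.Icc 1 (2 * k),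
      (-1) ^ j * f j * (f (2 * k - j) + algebraMap A R (e (2 * k - j))) = 0) :
    IsSpannedBy (Subalgebra.toSubmodule (Algebra.adjoin A (Set.range f))) (2 ^ n) := by
  refine ⟨(Finset.Icc 1 n).powerset.image fun T => ∏ i ∈ T, f i, ?_, ?_⟩
  · refine Finset.card_image_le.trans ?_
    rw [Finset.card_powerset, Nat.card_Icc, Nat.add_sub_cancel]
  · rw [Algebra.adjoin_eq_span, Submodule.span_le]
    intro x hx
    obtain ⟨s, hs, rfl⟩ := Submonoid.exists_multiset_of_mem_closure hx
    obtain ⟨t, rfl⟩ : ∃ t : Multiset ℕ, t.map f = s := by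
      clear hx
      induction s using Multiset.induction_on with
      | empty => exact ⟨0, rfl⟩
      | cons y s ih =>
        obtain ⟨t, rfl⟩ := ih fun z hz => hs z (Multiset.mem_cons_of_mem hz)
        obtain ⟨i, rfl⟩ := hs y (Multiset.mem_cons_self y _)
        exact ⟨i ::ₘ t, Multiset.map_cons _ _ _⟩
    exact multiset_prod_mem_span h0 hlt hrel t

end Squarefree

open scoped Classical Pointwise in
-- Reduction modulo the monic p leaves only powers of x below its degree, with coefficients in S.
theorem IsSpannedBy.sup_adjoin {S : Subalgebra A R} {N : ℕ}
    (hS : IsSpannedBy (Subalgebra.toSubmodule S) N) {x : R} {p : Polynomial S} (hp : p.Monic)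
    (hd : 0 < p.natDegree) (hx : Polynomial.aeval x p = 0) :
    IsSpannedBy (Subalgebra.toSubmodule (S ⊔ Algebra.adjoin A {x})) (N * p.natDegree) := by
  obtain ⟨s, hs, hspan⟩ := hS
  refine ⟨s * (Finset.range p.natDegree).image (x ^ ·), ?_, ?_⟩
  · refine Finset.card_mul_le.trans (Nat.mul_le_mul hs ?_)
    exact Finset.card_image_le.trans (Finset.card_range _).le
  have hrange : S ⊔ Algebra.adjoin A {x} ≤
      ((Polynomial.aeval x : Polynomial S →ₐ[S] R).restrictScalars A).range := by
    refine sup_le (fun y hy => ?_) (Algebra.adjoin_le ?_)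
    · exact ⟨Polynomial.C ⟨y, hy⟩, Polynomial.aeval_C x _⟩
    · rintro y rfl
      exact ⟨Polynomial.X, Polynomial.aeval_X y⟩
  intro y hy
  obtain ⟨q, hq⟩ := hrange hy
  change Polynomial.aeval x q = y at hq
  have hne : p ≠ 1 := by
    rintro rfl
    simp at hd
  rw [← hq, ← Polynomial.aeval_modByMonic_eq_self_of_root hx,
    Polynomial.aeval_eq_sum_range' (Polynomial.natDegree_modByMonic_lt q hp hne)]
  refine Submodule.sum_mem _ fun i hi => ?_
  rw [Finset.coe_mul, ← Submodule.span_mul_span, Algebra.smul_def]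
  refine Submodule.mul_mem_mul (hspan (Subtype.mem _)) (Submodule.subset_span ?_)
  exact Finset.mem_coe.2 (Finset.mem_image_of_mem _ hi)

variable {n : ℕ} {f : ℕ → R} {e : ℕ → A} {τ : Fin n → R}

/-- The subalgebra generated by all `f_i` and by `τ_j` for `j < k`. -/
def partialAdjoin (A : Type*) [CommRing A] [Algebra A R] (f : ℕ → R) (τ : Fin n → R) (k : ℕ) :
    Subalgebra A R :=
  Algebra.adjoin A (Set.range f ∪ τ '' {j | j < k})

/-- The polynomial is ∏_{j≥k}(X - τ_j). Its coefficients lie in the subalgebra because it is the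
quotient of ∏(X - τ_j) over all j, with coefficients ±(e_j + 2f_j), by the monic product over j < k.
-/
theorem exists_monic_root [Nontrivial R] (k : Fin n)
    (hτ : ∀ j, esymmAt τ j = algebraMap A R (e j) + 2 * f j) :
    ∃ p : Polynomial (partialAdjoin A f τ k), p.Monic ∧ p.natDegree = n - k ∧
      Polynomial.aeval (τ k) p = 0 := by
  set S := partialAdjoin A f τ k with hS
  have hfS : ∀ j, f j ∈ S := fun j => Algebra.subset_adjoin (Or.inl ⟨j, rfl⟩)
  have hτS : ∀ j : Fin n, j < k → τ j ∈ S := fun j hj =>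
    Algebra.subset_adjoin (Or.inr ⟨j, hj, rfl⟩)
  let F : Polynomial S := ∑ j ∈ Finset.range (n + 1),
    (-1) ^ j * (Polynomial.C (algebraMap A S (e j) + 2 * ⟨f j, hfS j⟩) * Polynomial.X ^ (n - j))
  let P : Polynomial S :=
    ∏ j ∈ (Finset.Iio k).attach,
      (Polynomial.X - Polynomial.C ⟨τ j.1, hτS j.1 (Finset.mem_Iio.1 j.2)⟩)
  have hP : P.Monic := Polynomial.monic_prod_of_monic _ _ fun j _ => Polynomial.monic_X_sub_C _
  let φ : S →+* R := algebraMap S R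
  have hφ : Function.Injective φ := Subtype.val_injective
  have hF : F.map φ = ∏ j, (Polynomial.X - Polynomial.C (τ j)) := by
    rw [prod_X_sub_C_eq_sum_esymmAt, Polynomial.map_sum]
    refine Finset.sum_congr rfl fun j _ => ?_
    have h1 : φ (algebraMap A S (e j) + 2 * ⟨f j, hfS j⟩) = esymmAt τ j := by
      rw [hτ, map_add, map_mul, map_ofNat]
      rfl
    simp only [Polynomial.map_mul, Polynomial.map_pow, Polynomial.map_neg, Polynomial.map_one,
      Polynomial.map_C, Polynomial.map_X, h1]
  have hPφ : P.map φ = ∏ j ∈ Finset.Iio k, (Polynomial.X - Polynomial.C (τ j)) := by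
    rw [Polynomial.map_prod,
      ← Finset.prod_attach (Finset.Iio k) fun j => (Polynomial.X - Polynomial.C (τ j))]
    refine Finset.prod_congr rfl fun j _ => ?_
    rw [Polynomial.map_sub, Polynomial.map_X, Polynomial.map_C]
    rfl
  have hsplit : F.map φ = P.map φ * ∏ j ∈ Finset.Ici k, (Polynomial.X - Polynomial.C (τ j)) := by
    rw [hF, hPφ, ← Finset.prod_union]
    · refine Finset.prod_congr ?_ fun _ _ => rfl
      ext i
      simp [lt_or_ge]
    · rw [Finset.disjoint_left]
      intro i hi hi'
      exact absurd (Finset.mem_Iio.1 hi) (not_lt.2 (Finset.mem_Ici.1 hi'))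
  have hQ : (F /ₘ P).map φ = ∏ j ∈ Finset.Ici k, (Polynomial.X - Polynomial.C (τ j)) := by
    rw [Polynomial.map_divByMonic _ hP, hsplit,
      Polynomial.mul_divByMonic_cancel_left _ (hP.map φ)]
  refine ⟨F /ₘ P, Polynomial.monic_of_injective hφ ?_, ?_, ?_⟩
  · rw [hQ]
    exact Polynomial.monic_prod_of_monic _ _ fun j _ => Polynomial.monic_X_sub_C _
  · rw [← Polynomial.natDegree_map_eq_of_injective hφ, hQ,
      Polynomial.natDegree_finsetProd_X_sub_C_eq_card, Fin.card_Ici]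
  · rw [Polynomial.aeval_def, ← Polynomial.eval_map, hQ, Polynomial.eval_prod]
    exact Finset.prod_eq_zero (Finset.mem_Ici.2 le_rfl) (by simp)

theorem partialAdjoin_succ (k : Fin n) :
    partialAdjoin A f τ (k + 1) = partialAdjoin A f τ k ⊔ Algebra.adjoin A {τ k} := by
  rw [partialAdjoin, partialAdjoin, ← Algebra.adjoin_union, Set.union_assoc]
  congr 2
  ext x
  constructor
  · rintro ⟨j, hj, rfl⟩
    rcases Nat.lt_succ_iff_lt_or_eq.1 hj with hj | hj
    · exact Or.inl ⟨j, hj, rfl⟩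
    · exact Or.inr (congrArg τ (Fin.ext hj))
  · rintro (⟨j, hj, rfl⟩ | rfl)
    · exact ⟨j, Nat.lt_succ_of_lt hj, rfl⟩
    · exact ⟨k, Nat.lt_succ_self _, rfl⟩

theorem isSpannedBy_partialAdjoin [Nontrivial R] (h0 : f 0 = 0) (hlt : ∀ l, n < l → f l = 0)
    (hrel : ∀ k ∈ Finset.Icc 1 n, ∑ j ∈ Finset.Icc 1 (2 * k),
      (-1) ^ j * f j * (f (2 * k - j) + algebraMap A R (e (2 * k - j))) = 0)
    (hτ : ∀ j, esymmAt τ j = algebraMap A R (e j) + 2 * f j) {k : ℕ} (hk : k ≤ n) :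
    IsSpannedBy (Subalgebra.toSubmodule (partialAdjoin A f τ k))
      (2 ^ n * n.descFactorial k) := by
  induction k with
  | zero =>
    rw [Nat.descFactorial_zero, mul_one, partialAdjoin]
    simpa using isSpannedBy_adjoin_range h0 hlt hrel
  | succ k ih =>
    obtain ⟨p, hp, hd, hx⟩ := exists_monic_root (⟨k, hk⟩ : Fin n) hτ
    have h := (ih (Nat.le_of_succ_le hk)).sup_adjoin hp (by rw [hd]; exact Nat.sub_pos_of_lt hk) hx
    rw [hd, mul_assoc, mul_comm (n.descFactorial k)] at h
    have h2 := partialAdjoin_succ (A := A) (f := f) (τ := τ) ⟨k, hk⟩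
    rw [Nat.descFactorial_succ]
    rw [← h2] at h
    exact h

theorem isSpannedBy_top [Nontrivial R] (h0 : f 0 = 0) (hlt : ∀ l, n < l → f l = 0)
    (hrel : ∀ k ∈ Finset.Icc 1 n, ∑ j ∈ Finset.Icc 1 (2 * k),
      (-1) ^ j * f j * (f (2 * k - j) + algebraMap A R (e (2 * k - j))) = 0)
    (hτ : ∀ j, esymmAt τ j = algebraMap A R (e j) + 2 * f j)
    (htop : Algebra.adjoin A (Set.range f ∪ Set.range τ) = ⊤) :
    IsSpannedBy (⊤ : Submodule A R) (2 ^ n * n.factorial) := by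
  have h := isSpannedBy_partialAdjoin h0 hlt hrel hτ le_rfl
  have huniv : {j : Fin n | (j : ℕ) < n} = Set.univ := Set.eq_univ_of_forall fun j => j.2
  rwa [Nat.descFactorial_self, partialAdjoin, huniv, Set.image_univ, htop,
    Algebra.top_toSubmodule] at h

end Spanning

/-! ### A determinant criterion for joint injectivity -/

section LinearAlgebra
variable {A M V : Type*} [CommRing A] [IsDomain A] [AddCommGroup M] [Module A M]

/-- If `M` is spanned by as many elements as there are linear forms in a family that separates
points, then these forms are jointly injective. -/
theorem eq_zero_of_forall_eq_zero [Fintype V] [DecidableEq V] (ev : V → M →ₗ[A] A)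
    {b : V → M} (hb : Submodule.span A (Set.range b) = ⊤)
    (hδ : ∀ v, ∃ x, ev v x ≠ 0 ∧ ∀ v', v' ≠ v → ev v' x = 0) {x : M} (hx : ∀ v, ev v x = 0) :
    x = 0 := by
  have hrep : ∀ y : M, ∃ c : V → A, ∑ i, c i • b i = y := fun y =>
    (Submodule.mem_span_range_iff_exists_fun A).1 (hb ▸ Submodule.mem_top)
  choose δ hδ hδ' using hδ
  choose c hc using fun v => hrep (δ v)
  let B : Matrix V V A := Matrix.of fun i v => ev v (b i)
  let C : Matrix V V A := Matrix.of c
  -- Expanding the separating elements δ in the spanning family factors a diagonal matrix with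
  -- nonzero entries through B, so det B ≠ 0.
  have hCB : C * B = Matrix.diagonal fun v => ev v (δ v) := by
    ext v v'
    have h1 : (C * B) v v' = ev v' (δ v) := by
      rw [← hc v, map_sum, Matrix.mul_apply]
      simp [B, C]
    rw [h1, Matrix.diagonal_apply]
    split_ifs with h
    · rw [h]
    · exact hδ' v v' (Ne.symm h)
  have hdet : B.det ≠ 0 := by
    intro h
    have h1 := congrArg Matrix.det hCB
    rw [Matrix.det_mul, h, mul_zero, Matrix.det_diagonal, eq_comm, Finset.prod_eq_zero_iff] at h1
    obtain ⟨v, -, hv⟩ := h1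
    exact hδ v hv
  obtain ⟨a, rfl⟩ := hrep x
  have ha : a = 0 := by
    refine Matrix.eq_zero_of_vecMul_eq_zero hdet (funext fun v => ?_)
    have := hx v
    rw [map_sum] at this
    simpa [Matrix.vecMul, dotProduct, B] using this
  simp [ha]

end LinearAlgebra

/-! ### Injectivity on the quotient -/

section Injectivity
variable {n : ℕ}

theorem eTau_eq_esymmAt (k : ℕ) : eTau n k = esymmAt (fun i => X (Gen.tau i)) k := by
  simp [eTau, esymmAt_eq_sum, esymm]

theorem eT_eq_rename (k : ℕ) : eT n k = rename Gen.t (esymmAt (X : Fin n → HBT n) k) := by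
  exact congrArg (rename Gen.t) (aeval_X_left_apply _).symm

theorem exists_tauAt_ne {w w' : weylGroup (rootsB n)} (h : w' ≠ w) :
    ∃ i, tauAt w i ≠ tauAt w' i := by
  by_contra! h'
  exact h (Subtype.ext (linearEquiv_ext_tBasis fun i => (toHBT_injective (h' i)).symm))

/-- Multiply, over all other vertices `w'`, a difference τ_i - τ_i(w') that is nonzero at `w`. -/
theorem exists_evalAt_separating (w : weylGroup (rootsB n)) :
    ∃ p, evalAt w p ≠ 0 ∧ ∀ w', w' ≠ w → evalAt w' p = 0 := by
  classical
  have := Fintype.ofFinite (weylGroup (rootsB n))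
  have hsep : ∀ w', w' ≠ w → ∃ p, evalAt w p ≠ 0 ∧ evalAt w' p = 0 := by
    intro w' h
    obtain ⟨i, hi⟩ := exists_tauAt_ne h
    exact ⟨X (.tau i) - rename Gen.t (tauAt w' i), by simpa using sub_ne_zero.2 hi, by simp⟩
  choose! p hp hp' using hsep
  refine ⟨∏ w' ∈ Finset.univ.erase w, p w', ?_, fun w' hw' => ?_⟩
  · rw [map_prod, Finset.prod_ne_zero_iff]
    exact fun w' hw' => hp w' (Finset.ne_of_mem_erase hw')
  · rw [map_prod]
    exact Finset.prod_eq_zero (Finset.mem_erase.2 ⟨hw', Finset.mem_univ w'⟩) (hp' w' hw')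

variable {R : Type*} [CommRing R] [Algebra (HBT n) R]

theorem isSpannedBy_of_surjective [Nontrivial R] {q : PolyB n →+* R}
    (hq : Function.Surjective q) (halg : ∀ a, algebraMap (HBT n) R a = q (rename Gen.t a))
    (hzero : ∀ p ∈ idealB n, q p = 0) :
    IsSpannedBy (⊤ : Submodule (HBT n) R) (2 ^ n * n.factorial) := by
  have hfgt : ∀ l, n < l → fVar n l = 0 := by
    intro l hl
    obtain ⟨l, rfl⟩ := Nat.exists_eq_succ_of_ne_zero (Nat.ne_of_gt (Nat.zero_lt_of_lt hl))
    rw [fVar, dif_neg (by omega)]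
  refine isSpannedBy_top (f := fun k => q (fVar n k)) (e := esymmAt (X : Fin n → HBT n))
    (τ := fun i => q (X (.tau i))) (map_zero q) (fun l hl => ?_) (fun k hk => ?_) (fun j => ?_) ?_
  · rw [hfgt l hl, map_zero]
  · have h := hzero _ (Ideal.subset_span (Or.inr ⟨k, hk, rfl⟩))
    rw [map_sum] at h
    refine Eq.trans (Finset.sum_congr rfl fun j _ => ?_) h
    rw [halg, ← eT_eq_rename, map_mul, map_mul, map_pow, map_neg, map_one, map_add]
  · rw [← map_esymmAt q, ← eTau_eq_esymmAt, halg, ← eT_eq_rename]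
    rcases Nat.eq_zero_or_pos j with rfl | hj
    · rw [eTau_eq_esymmAt, eT_eq_rename, esymmAt_zero, esymmAt_zero]
      simp [fVar]
    by_cases hjn : n < j
    · rw [eTau_eq_esymmAt, eT_eq_rename, esymmAt_of_lt _ hjn, esymmAt_of_lt _ hjn, hfgt j hjn]
      simp
    · have h := hzero _ (Ideal.subset_span
        (Or.inl ⟨j, Finset.mem_Icc.2 ⟨hj, not_lt.1 hjn⟩, rfl⟩))
      rw [map_add, map_sub, map_mul, map_ofNat] at h
      linear_combination -h
  · rw [eq_top_iff]
    rintro x -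
    obtain ⟨p, rfl⟩ := hq x
    induction p using MvPolynomial.induction_on with
    | C a =>
      have := Subalgebra.algebraMap_mem (Algebra.adjoin (HBT n)
        (Set.range (fun k => q (fVar n k)) ∪ Set.range fun i => q (X (.tau i)))) (C a)
      rwa [halg, rename_C] at this
    | add p r hp hr =>
      rw [map_add]
      exact add_mem hp hr
    | mul_X p g hp =>
      rw [map_mul]
      refine mul_mem hp ?_
      cases g with
      | tau i => exact Algebra.subset_adjoin (Or.inr ⟨i, rfl⟩)
      | t i =>
        have := Subalgebra.algebraMap_mem (Algebra.adjoin (HBT n)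
          (Set.range (fun k => q (fVar n k)) ∪ Set.range fun i => q (X (.tau i)))) (X i)
        rwa [halg, rename_X] at this
      | f i =>
        refine Algebra.subset_adjoin (Or.inl ⟨i + 1, ?_⟩)
        change q (fVar n (i + 1)) = q (X (.f i))
        rw [fVar, dif_pos i.2]

theorem eq_zero_of_evalAt_eq_zero {q : PolyB n →+* R} (hq : Function.Surjective q)
    (halg : ∀ a, algebraMap (HBT n) R a = q (rename Gen.t a)) (hzero : ∀ p ∈ idealB n, q p = 0)
    {ev : weylGroup (rootsB n) → R →+* HBT n} (hev : ∀ w p, ev w (q p) = evalAt w p) {p : PolyB n}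
    (hp : ∀ w : weylGroup (rootsB n), evalAt w p = 0) : q p = 0 := by
  classical
  have := Fintype.ofFinite (weylGroup (rootsB n))
  have : Nontrivial R := (ev 1).domain_nontrivial
  obtain ⟨s, hs, hspan⟩ := isSpannedBy_of_surjective hq halg hzero
  have hcard : Fintype.card s ≤ Fintype.card (weylGroup (rootsB n)) := by
    rw [Fintype.card_coe, ← Nat.card_eq_fintype_card]
    exact hs.trans card_weylGroup_rootsB_ge
  obtain ⟨ι⟩ := Function.Embedding.nonempty_of_card_le hcard
  -- Index the spanning set by vertices, padding with zeros, to make the evaluation matrix square.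
  let b : weylGroup (rootsB n) → R := Function.extend ι (fun x => x.1) 0
  have hb : Submodule.span (HBT n) (Set.range b) = ⊤ := by
    rw [eq_top_iff]
    refine hspan.trans (Submodule.span_mono fun x hx => ⟨ι ⟨x, hx⟩, ?_⟩)
    exact ι.injective.extend_apply _ _ _
  let evₗ : weylGroup (rootsB n) → R →ₗ[HBT n] HBT n := fun w =>
    { toFun := ev w
      map_add' := map_add _
      map_smul' := by
        intro a x
        rw [Algebra.smul_def, map_mul, RingHom.id_apply, smul_eq_mul, halg, hev, evalAt_rename_t] }
  refine eq_zero_of_forall_eq_zero evₗ hb (fun w => ?_) fun w => (hev w p).trans (hp w)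
  obtain ⟨r, hr, hr'⟩ := exists_evalAt_separating w
  exact ⟨q r, fun h => hr ((hev w r).symm.trans h), fun w' hw' => (hev w' r).trans (hr' w' hw')⟩

/-- A polynomial vanishing at every vertex is a consequence of the defining relations. -/
theorem mem_idealB_of_evalAt_eq_zero {p : PolyB n}
    (hp : ∀ w : weylGroup (rootsB n), evalAt w p = 0) : p ∈ idealB n := by
  let q : PolyB n →+* PolyB n ⧸ idealB n := Ideal.Quotient.mk (idealB n)
  let _ : Algebra (HBT n) (PolyB n ⧸ idealB n) :=
    (q.comp (rename Gen.t : HBT n →ₐ[ℤ] PolyB n).toRingHom).toAlgebra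
  exact Ideal.Quotient.eq_zero_iff_mem.1 (eq_zero_of_evalAt_eq_zero (q := q)
    (ev := fun w => Ideal.Quotient.lift (idealB n) (evalAt w).toRingHom (idealB_le_ker w))
    Ideal.Quotient.mk_surjective (fun _ => rfl) (fun _ h => Ideal.Quotient.eq_zero_iff_mem.2 h)
    (fun _ _ => rfl) hp)

end Injectivity

/-! ### Compatibility with the gradings -/

section Grading
variable {n : ℕ}

theorem isWeightedHomogeneous_toHBT (v : H2 n) :
    IsWeightedHomogeneous (fun _ : Fin n => 2) (toHBT v) 2 := by
  refine IsWeightedHomogeneous.sum _ _ _ fun i _ => ?_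
  rw [smul_eq_C_mul]
  exact (isWeightedHomogeneous_X ℤ _ i).C_mul _

theorem isWeightedHomogeneous_esymmAt {a : Fin n → HBT n}
    (ha : ∀ i, IsWeightedHomogeneous (fun _ : Fin n => 2) (a i) 2) (k : ℕ) :
    IsWeightedHomogeneous (fun _ : Fin n => 2) (esymmAt a k) (2 * k) := by
  rw [esymmAt_eq_sum]
  refine IsWeightedHomogeneous.sum _ _ _ fun t ht => ?_
  have h := IsWeightedHomogeneous.prod t a (fun _ => 2) fun i _ => ha i
  rwa [Finset.sum_const, (Finset.mem_powersetCard.1 ht).2, smul_eq_mul, mul_comm] at h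

theorem isWeightedHomogeneous_genAt (w : weylGroup (rootsB n)) (g : Gen n) :
    IsWeightedHomogeneous (fun _ : Fin n => 2) (genAt w g) g.deg := by
  cases g with
  | tau i => exact isWeightedHomogeneous_toHBT _
  | t i => exact isWeightedHomogeneous_X ℤ _ i
  | f i =>
    have h := (isWeightedHomogeneous_esymmAt
      (fun i => isWeightedHomogeneous_toHBT (w.1 (tBasis i))) (i + 1)).sub
      (isWeightedHomogeneous_esymmAt (isWeightedHomogeneous_X ℤ fun _ : Fin n => 2) (i + 1))
    change IsWeightedHomogeneous _ (esymmAt (tauAt w) (i + 1) - _) _ at h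
    rw [← two_mul_halfDiff] at h
    intro c hc
    refine h ?_
    rw [← map_ofNat C, coeff_C_mul]
    exact mul_ne_zero two_ne_zero hc

/-- Each generator evaluates to a form of its own degree, so monomials keep their degree. -/
theorem weightedHomogeneousComponent_evalAt (w : weylGroup (rootsB n)) (d : ℕ) (p : PolyB n) :
    weightedHomogeneousComponent (fun _ : Fin n => 2) d (evalAt w p) =
      evalAt w (weightedHomogeneousComponent Gen.deg d p) := by
  induction p using MvPolynomial.induction_on' with
  | monomial m a =>
    have h1 : IsWeightedHomogeneous (fun _ : Fin n => 2) (evalAt w (monomial m a))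
        (Finsupp.weight Gen.deg m) := by
      rw [evalAt, aeval_monomial, Finsupp.weight_apply]
      refine IsWeightedHomogeneous.C_mul ?_ a
      exact IsWeightedHomogeneous.prod _ _ _ fun g _ => (isWeightedHomogeneous_genAt w g).pow _
    rw [weightedHomogeneousComponent_of_mem h1, weightedHomogeneousComponent_of_mem
      (isWeightedHomogeneous_monomial Gen.deg m a rfl)]
    split_ifs
    · rfl
    · rw [map_zero]
  | add p q hp hq => rw [map_add, map_add, map_add, map_add, hp, hq]

theorem isWeightedHomogeneous_evalAt (w : weylGroup (rootsB n)) {d : ℕ} {p : PolyB n}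
    (hp : IsWeightedHomogeneous Gen.deg p d) :
    IsWeightedHomogeneous (fun _ : Fin n => 2) (evalAt w p) d := by
  rw [← weightedHomogeneousComponent_eq_self hp, ← weightedHomogeneousComponent_evalAt]
  exact weightedHomogeneousComponent_isWeightedHomogeneous d _

end Grading

/-! ### Assembling the isomorphism -/

section Isomorphism
variable {n : ℕ}

/-- The homomorphism from the polynomial ring to the graph cohomology. -/
noncomputable def toGraphCohomology (n : ℕ) : PolyB n →+* graphCohomology (graphB n) :=
  RingHom.codRestrict
    (RingHom.pi fun w : weylGroup (rootsB n) => (evalAt w).toRingHom :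
      PolyB n →+* ((graphB n).V → HBT n))
    (graphCohomology (graphB n)) (by
      rintro p w w' l ⟨α, hα, s, hs, hw', rfl⟩
      exact toHBT_dvd_evalAt_sub hα hs hw' p)

theorem toGraphCohomology_apply (p : PolyB n) (w : weylGroup (rootsB n)) :
    (toGraphCohomology n p).1 w = evalAt w p := rfl

theorem mem_graphCohomology_iff {h : weylGroup (rootsB n) → HBT n} :
    (h : (graphB n).V → HBT n) ∈ graphCohomology (graphB n) ↔ IsGKMOn Set.univ h := by
  constructor
  · intro hh w _ w' _ α hα s hs hw'
    exact hh w w' _ ⟨α, hα, s, hs, hw', rfl⟩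
  · rintro hh w w' l ⟨α, hα, s, hs, hw', rfl⟩
    exact hh w trivial w' trivial α hα s hs hw'

theorem toGraphCohomology_ext {p : PolyB n} {h : graphCohomology (graphB n)}
    (hp : ∀ w : weylGroup (rootsB n), evalAt w p = h.1 w) : toGraphCohomology n p = h :=
  Subtype.ext (funext hp)

theorem toGraphCohomology_surjective : Function.Surjective (toGraphCohomology n) := by
  intro h
  obtain ⟨p, hp⟩ := exists_evalAt_eq (mem_graphCohomology_iff.1 h.2)
  exact ⟨p, toGraphCohomology_ext fun w => (hp w).symm⟩

theorem ker_toGraphCohomology : RingHom.ker (toGraphCohomology n) = idealB n := by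
  ext p
  rw [RingHom.mem_ker]
  constructor
  · intro h
    refine mem_idealB_of_evalAt_eq_zero fun w => ?_
    rw [← toGraphCohomology_apply, h]
    rfl
  · exact fun h => toGraphCohomology_ext fun w => RingHom.mem_ker.1 (idealB_le_ker w h)

/-- A homogeneous lift is the degree d component of any lift. -/
theorem isInDegree_toGraphCohomology_iff {p : PolyB n} {d : ℕ} :
    IsInDegree (toGraphCohomology n p) d ↔
      ∃ q : PolyB n, IsWeightedHomogeneous Gen.deg q d ∧
        toGraphCohomology n q = toGraphCohomology n p := by
  constructor
  · intro h
    refine ⟨weightedHomogeneousComponent Gen.deg d p,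
      weightedHomogeneousComponent_isWeightedHomogeneous d p, toGraphCohomology_ext fun w => ?_⟩
    have hw : IsWeightedHomogeneous (fun _ : Fin n => 2) (evalAt w p) d := h w
    rw [← weightedHomogeneousComponent_evalAt, weightedHomogeneousComponent_eq_self hw]
    rfl
  · rintro ⟨q, hq, hqp⟩
    rw [← hqp]
    intro w
    exact isWeightedHomogeneous_evalAt w hq

theorem aeval_esymm_apply (a : Fin n → (graphB n).V → HBT n) (k : ℕ) (w : (graphB n).V) :
    aeval a (esymm (Fin n) ℤ k) w = esymmAt (fun i => a i w) k :=
  map_esymmAt (Pi.evalRingHom (fun _ : (graphB n).V => HBT n) w) a k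

end Isomorphism
end GKM

theorem mainTheorem3 (n : ℕ) :
    ∃ Θ : (GKM.PolyB n ⧸ GKM.idealB n) ≃+* GKM.graphCohomology (GKM.graphB n),
      (∀ i : Fin n,
        (Θ (Ideal.Quotient.mk _ (MvPolynomial.X (GKM.Gen.tau i)))).1 = GKM.tau i) ∧
      (∀ i : Fin n,
        (Θ (Ideal.Quotient.mk _ (MvPolynomial.X (GKM.Gen.t i)))).1 = GKM.tConst i) ∧
      (∀ i : Fin n,
        2 * (Θ (Ideal.Quotient.mk _ (MvPolynomial.X (GKM.Gen.f i)))).1 =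
          MvPolynomial.aeval GKM.tau (MvPolynomial.esymm (Fin n) ℤ (i + 1)) -
            MvPolynomial.aeval GKM.tConst (MvPolynomial.esymm (Fin n) ℤ (i + 1))) ∧
      (∀ (d : ℕ) (h : GKM.graphCohomology (GKM.graphB n)),
        GKM.IsInDegree h d ↔
          ∃ p : GKM.PolyB n, MvPolynomial.IsWeightedHomogeneous GKM.Gen.deg p d ∧
            Θ (Ideal.Quotient.mk _ p) = h) := by
  let Θ : (GKM.PolyB n ⧸ GKM.idealB n) ≃+* GKM.graphCohomology (GKM.graphB n) :=
    (Ideal.quotEquivOfEq GKM.ker_toGraphCohomology.symm).trans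
      (RingHom.quotientKerEquivOfSurjective GKM.toGraphCohomology_surjective)
  have hΘ : ∀ p, Θ (Ideal.Quotient.mk _ p) = GKM.toGraphCohomology n p := fun _ => rfl
  refine ⟨Θ, fun i => ?_, fun i => ?_, fun i => ?_, fun d h => ?_⟩
  · exact funext fun w => GKM.evalAt_tau w i
  · exact funext fun w => GKM.evalAt_t w i
  · funext w
    refine Eq.trans ?_ (congrArg₂ (· - ·) (GKM.aeval_esymm_apply GKM.tau (i + 1) w)
      (GKM.aeval_esymm_apply GKM.tConst (i + 1) w)).symm
    exact (congrArg (2 * ·) (GKM.evalAt_f w i)).trans (GKM.two_mul_halfDiff w (i + 1))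
  · obtain ⟨p, rfl⟩ := GKM.toGraphCohomology_surjective h
    exact GKM.isInDegree_toGraphCohomology_iff
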